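/- Let $\Gamma$ be a discrete group of type $FP_\infty(\mathbb{Q})$, i.e. for every $m$ the trivial $\mathbb{Q}\Gamma$-module $\mathbb{Q}$ has a projective resolution that is finitely generated in degrees $\le m$. Let $n\ge 1$. Property $(T_n)$ means: $H^j(\Gamma,V)=0$ for all $1\le j\le n$ and every unitary representation of $\Gamma$ on a complex Hilbert space $V$ without nonzero $\Gamma$-invariant vectors. Then $\mathbb{Q}$ has a resolution $$0\leftarrow \mathbb{Q}\leftarrow(\mathbb{Q}\Gamma)^{m_0}\xleftarrow{d_1}(\mathbb{Q}\Gamma)^{m_1}\xleftarrow{d_2}(\mathbb{Q}\Gamma)^{m_2}\leftarrow\cdots$$ by finitely generated based free left $\mathbb{Q}\Gamma$-modules with $m_0=1$. For every such resolution, put $P_k=(\mathbb{C}\Gamma)^{m_k}$, let $d_k\colon P_k\to P_{k-1}$ also denote the complexified differential ($d_0=0$), let $d_k^*\colon P_{k-1}\to P_k$ be the map whose matrix with respect to the bases is the transpose of the matrix of $d_k$ with the involution $(a\gamma)^*=\bar a\gamma^{-1}$ of $\mathbb{C}\Gamma$ applied to all entries, and let $\Delta_k=d_k^*d_k+d_{k+1}d_{k+1}^*$,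 regarded as an element of the $*$-algebra $M_{m_k}(\mathbb{C}\Gamma)$; $\Delta_0$ is an element of $\mathbb{C}\Gamma$, viewed as a scalar matrix in every $M_{m_k}(\mathbb{C}\Gamma)$. Then $\Gamma$ has property $(T_n)$ if and only if for every $0\le k\le n$ there are a real number $\epsilon>0$ and finitely many $x_1,\dots,x_j\in M_{m_k}(\mathbb{C}\Gamma)$ with $$\Delta_0(\Delta_k-\epsilon)\Delta_0=\sum_{i=1}^j x_i^*x_i .$$ -/

import Mathlib

open scoped Matrix

noncomputable section

namespace HigherT

/-! ### The involution of the complex group algebra -/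

section Involution

variable {Γ : Type} [Group Γ]

/-- The canonical involution of `ℂΓ`: it is conjugate-linear and sends `a • γ` to `ā • γ⁻¹`. -/
def involution (x : MonoidAlgebra ℂ Γ) : MonoidAlgebra ℂ Γ :=
  MonoidAlgebra.mapDomain (fun γ : Γ => γ⁻¹) (MonoidAlgebra.mapRingHom Γ (starRingEnd ℂ) x)

@[simp]
theorem involution_single (γ : Γ) (a : ℂ) :
    involution (MonoidAlgebra.single γ a) = MonoidAlgebra.single γ⁻¹ (starRingEnd ℂ a) := by
  simp [involution]

theorem involution_add (x y : MonoidAlgebra ℂ Γ) :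
    involution (x + y) = involution x + involution y := by
  simp [involution, MonoidAlgebra.mapDomain_add]

theorem involution_involution (x : MonoidAlgebra ℂ Γ) : involution (involution x) = x := by
  induction x using MonoidAlgebra.induction_linear with
  | zero => simp [involution]
  | add f g hf hg => rw [involution_add, involution_add, hf, hg]
  | single γ a => simp

theorem involution_mul (x y : MonoidAlgebra ℂ Γ) :
    involution (x * y) = involution y * involution x := by
  induction x using MonoidAlgebra.induction_linear with
  | zero => simp [involution]
  | add f g hf hg => rw [add_mul, involution_add, involution_add, hf, hg, mul_add]
  | single γ a =>
    induction y using MonoidAlgebra.induction_linear with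
    | zero => simp [involution]
    | add f g hf hg => rw [mul_add, involution_add, involution_add, hf, hg, add_mul]
    | single δ b => simp [MonoidAlgebra.single_mul_single, mul_comm]

/-- `ℂΓ` as a ring with involution. In particular `Xᴴ` is, for a matrix `X` over `ℂΓ`, the
transpose of `X` with the involution applied to every entry. -/
instance : StarRing (MonoidAlgebra ℂ Γ) where
  star := involution
  star_involutive := involution_involution
  star_mul := involution_mul
  star_add := involution_add

theorem star_single (γ : Γ) (a : ℂ) :
    star (MonoidAlgebra.single γ a) = MonoidAlgebra.single γ⁻¹ (starRingEnd ℂ a) :=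
  involution_single γ a

end Involution

/-! ### Higher property T -/

/-- Property `(T_n)` of a (discrete) group `Γ`: for every unitary representation of `Γ` on a complex
Hilbert space `V` without nonzero invariant vectors, `H^j(Γ, V) = 0` for `1 ≤ j ≤ n`. A unitary
representation is a linear representation by norm-preserving (automatically invertible) maps. -/
def PropertyT (n : ℕ) (Γ : Type) [Group Γ] : Prop :=
  ∀ (V : Type) [NormedAddCommGroup V] [InnerProductSpace ℂ V] [CompleteSpace V]
    (π : Representation ℂ Γ V),
    (∀ γ v, ‖π γ v‖ = ‖v‖) →
    (∀ v, (∀ γ, π γ v = v) → v = 0) →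
    ∀ j : ℕ, 1 ≤ j → j ≤ n → Subsingleton (groupCohomology (Rep.of π) j)

/-! ### Finiteness properties and resolutions -/

/-- The trivial `ℚΓ`-module `ℚ`. -/
abbrev TrivialQ (Γ : Type) [Group Γ] : Type := (Representation.trivial ℚ Γ ℚ).asModule

/-- Property `FP_n(ℚ)`: the trivial module `ℚ` has a projective resolution over `ℚΓ` which is
finitely generated in degrees up to `n`. -/
def IsFP (n : ℕ) (Γ : Type) [Group Γ] : Prop :=
  ∃ P : CategoryTheory.ProjectiveResolution
      (ModuleCat.of (MonoidAlgebra ℚ Γ) (TrivialQ Γ)),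
    ∀ i ≤ n, Module.Finite (MonoidAlgebra ℚ Γ) (P.complex.X i)

/-- Property `FP_∞(ℚ)`: property `FP_n(ℚ)` for all `n`. -/
def IsFPInfty (Γ : Type) [Group Γ] : Prop := ∀ n, IsFP n Γ

/-- A based resolution of the trivial `ℚΓ`-module `ℚ` by finitely generated free left modules
`(ℚΓ)^{m_k}`, with their standard bases, such that `m_0 = 1`:
`0 ← ℚ ← (ℚΓ)^{m_0} ← (ℚΓ)^{m_1} ← ⋯`. -/
structure BasedResolution (Γ : Type) [Group Γ] where
  /-- the rank `m_k` of the free module in degree `k` -/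
  rank : ℕ → ℕ
  /-- the module in degree `0` is `ℚΓ` -/
  rank_zero : rank 0 = 1
  /-- the differential from degree `k + 1` to degree `k` -/
  d : ∀ k, (Fin (rank (k + 1)) → MonoidAlgebra ℚ Γ) →ₗ[MonoidAlgebra ℚ Γ]
    (Fin (rank k) → MonoidAlgebra ℚ Γ)
  /-- the augmentation -/
  aug : (Fin (rank 0) → MonoidAlgebra ℚ Γ) →ₗ[MonoidAlgebra ℚ Γ] TrivialQ Γ
  aug_surjective : Function.Surjective aug
  exact_zero : Function.Exact (d 0) aug
  exact_succ : ∀ k, Function.Exact (d (k + 1)) (d k)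

/-- The formal adjoint of a `ℂΓ`-linear map of based free left modules: the map whose matrix is the
conjugate transpose. Linear maps of left modules act on row vectors by right multiplication with
their matrix. -/
def formalAdjoint {Γ : Type} [Group Γ] {p q : ℕ}
    (f : (Fin p → MonoidAlgebra ℂ Γ) →ₗ[MonoidAlgebra ℂ Γ] (Fin q → MonoidAlgebra ℂ Γ)) :
    (Fin q → MonoidAlgebra ℂ Γ) →ₗ[MonoidAlgebra ℂ Γ] (Fin p → MonoidAlgebra ℂ Γ) :=
  Matrix.toLinearMapRight' (LinearMap.toMatrixRight' f)ᴴ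

namespace BasedResolution

variable {Γ : Type} [Group Γ] (R : BasedResolution Γ)

/-- The module `P_k = (ℂΓ)^{m_k}` of the complexified resolution. -/
abbrev P (k : ℕ) : Type := Fin (R.rank k) → MonoidAlgebra ℂ Γ

/-- The complexified differential `P_{k+1} → P_k`, which has the same matrix as `R.d k`. -/
def dC (k : ℕ) : R.P (k + 1) →ₗ[MonoidAlgebra ℂ Γ] R.P k :=
  Matrix.toLinearMapRight'
    ((LinearMap.toMatrixRight' (R.d k)).map (MonoidAlgebra.mapRingHom Γ (algebraMap ℚ ℂ)))

/-- The formal Laplace operator `Δ_k = d_k^* d_k + d_{k+1} d_{k+1}^*` on `P_k`, where `d_k` is the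
differential `P_k → P_{k-1}` and `d_0 = 0`. -/
def laplaceOperator : (k : ℕ) → R.P k →ₗ[MonoidAlgebra ℂ Γ] R.P k
  | 0 => R.dC 0 ∘ₗ formalAdjoint (R.dC 0)
  | k + 1 => formalAdjoint (R.dC k) ∘ₗ R.dC k + R.dC (k + 1) ∘ₗ formalAdjoint (R.dC (k + 1))

/-- The matrix of the formal Laplace operator, an element of `M_{m_k}(ℂΓ)`. -/
def laplacian (k : ℕ) : Matrix (Fin (R.rank k)) (Fin (R.rank k)) (MonoidAlgebra ℂ Γ) :=
  LinearMap.toMatrixRight' (R.laplaceOperator k)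

/-- `Δ_0`, a `1 × 1`-matrix, as an element of the group ring. -/
def laplacianZero : MonoidAlgebra ℂ Γ :=
  R.laplacian 0 ⟨0, by simp [R.rank_zero]⟩ ⟨0, by simp [R.rank_zero]⟩

end BasedResolution

end HigherT

end

/-! Let `R` be a based resolution of the trivial module. As `Γ` is of type `FP_∞`, such resolutions
exist: Schanuel's lemma makes all syzygies of the trivial module finitely generated, independently
of the projective resolutions that witness `FP_n` for the different `n` (`HasTypeFP.ker`,
`nonempty_basedResolution`). Applying `Hom(-, V)` to the complexified resolution shows that
`H^{k+1}(Γ, V)` is the cohomology of the complex `V^{m_k} → V^{m_{k+1}} → V^{m_{k+2}}` whose maps are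
the matrices of the differentials (`subsingleton_groupCohomology_iff`). The formal adjoint of a
matrix acts as its Hilbert space adjoint if the representation is unitary (`sum_inner_matAct`).

If `Δ₀ (Δ_k - ε) Δ₀` is a sum of squares, then `Δ_k ≥ ε` on the range of `Δ₀`. In a unitary
representation without invariant vectors the operator `Δ₀` is injective and self-adjoint, so its
range is dense and `Δ_k ≥ ε` everywhere (`coercive_of_sum_of_squares`). So `Δ_k` is invertible, and
cohomology vanishes in degree `k` by the Hodge decomposition (`propertyT_of_sum_of_squares`).

For the converse, consider the cone generated by the squares `r^* r` of row vectors with entries in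
the augmentation ideal. The matrix `Δ₀` is an order unit for this cone, because the ideal is
generated by the entries of `d_1`, and `Δ₀` is the sum of their squares
(`exists_smul_orderUnit_sub_mem`). By the Hahn-Banach theorem it suffices that every state on the
cone is positive on `Δ₀ Δ_k Δ₀` (`exists_sum_of_squares_of_forall_state`). The
Gelfand-Naimark-Segal construction turns a state into a unitary representation on a completion of
the module of such row vectors. An invariant vector in it gives homomorphisms from `Γ` to `ℂ`, which
vanish under property `(T_1)` (`complex_character_eq_zero`): a nonzero homomorphism `b` to `ℝ` would
give unitary characters `exp(i b / j)` so close to the trivial one that their Hilbert sum has a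
cocycle which is not a coboundary. So property `(T_n)` applies to the representation of the state
(`State.eq_zero_of_invariant`). If the state is not positive on `Δ₀ Δ_k Δ₀`, the rows of `Δ₀` form a
harmonic `k`-cochain, which must be zero. The rows with entries from `d_1` form `1`-cocycles, which
are coboundaries and, by the vanishing of the rows of `Δ₀`, orthogonal to all coboundaries; so they
are zero too, and the state vanishes on the order unit (`map_orderUnit_eq_zero`, `state_pos`). -/

/-! ### Finiteness properties and the existence of based resolutions -/

namespace HigherT

section Finiteness

variable {A : Type} [Ring A]

/-- Property `FP_n` of a module, by recursion on `n`: a module is of type `FP_0` if it is finitely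
generated, and of type `FP_{n+1}` if it is a quotient of a finitely generated based free module by
a submodule of type `FP_n`. -/
def HasTypeFP : ℕ → ∀ (M : Type) [AddCommGroup M] [Module A M], Prop
  | 0, M, _, _ => Module.Finite A M
  | n + 1, M, _, _ => ∃ (m : ℕ) (f : (Fin m → A) →ₗ[A] M),
      Function.Surjective f ∧ HasTypeFP n (LinearMap.ker f)

theorem HasTypeFP.congr {n : ℕ} {M M' : Type} [AddCommGroup M] [Module A M] [AddCommGroup M']
    [Module A M'] (e : M ≃ₗ[A] M') (h : HasTypeFP (A := A) n M) : HasTypeFP (A := A) n M' := by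
  cases n with
  | zero =>
    have : Module.Finite A M := h
    exact Module.Finite.equiv e
  | succ n =>
    obtain ⟨m, f, hf, hk⟩ := h
    refine ⟨m, e.toLinearMap ∘ₗ f, e.surjective.comp hf, ?_⟩
    rwa [LinearEquiv.ker_comp]

theorem HasTypeFP.finite {n : ℕ} {M : Type} [AddCommGroup M] [Module A M]
    (h : HasTypeFP (A := A) n M) : Module.Finite A M := by
  cases n with
  | zero => exact h
  | succ n =>
    obtain ⟨m, f, hf, -⟩ := h
    exact Module.Finite.of_surjective f hf

/-- A surjection onto a projective module splits. -/
theorem nonempty_equiv_ker_prod {Q P : Type} [AddCommGroup Q] [Module A Q] [AddCommGroup P]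
    [Module A P] [Module.Projective A P] (g : Q →ₗ[A] P) (hg : Function.Surjective g) :
    Nonempty (Q ≃ₗ[A] LinearMap.ker g × P) := by
  obtain ⟨s, hs⟩ := Module.projective_lifting_property g LinearMap.id hg
  have hs' : ∀ y, g (s y) = y := fun y => LinearMap.congr_fun hs y
  refine ⟨LinearEquiv.ofLinearMap
    (LinearMap.prod ((LinearMap.id - s ∘ₗ g).codRestrict _ fun x => by simp [hs']) g)
    (LinearMap.coprod (LinearMap.ker g).subtype s) ?_ ?_⟩
  · ext x
    · simp
    · simp
    · simp [hs']
    · simp [hs']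
  · ext x
    simp

theorem exists_equiv_fin_prod (p q : ℕ) :
    Nonempty ((Fin (p + q) → A) ≃ₗ[A] (Fin p → A) × (Fin q → A)) :=
  ⟨(LinearEquiv.funCongrLeft A A finSumFinEquiv).trans
    (LinearEquiv.sumArrowLequivProdArrow (Fin p) (Fin q) A A)⟩

/-- The inductive step in the definition of `HasTypeFP`, for a short exact sequence. -/
theorem HasTypeFP.of_exact {n m : ℕ} {K F M : Type} [AddCommGroup K] [Module A K]
    [AddCommGroup F] [Module A F] [AddCommGroup M] [Module A M] (e : (Fin m → A) ≃ₗ[A] F)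
    (i : K →ₗ[A] F) (f : F →ₗ[A] M) (hi : Function.Injective i) (hif : Function.Exact i f)
    (hf : Function.Surjective f) (hK : HasTypeFP (A := A) n K) :
    HasTypeFP (A := A) (n + 1) M := by
  refine ⟨m, f ∘ₗ e.toLinearMap, hf.comp e.surjective, ?_⟩
  refine HasTypeFP.congr ?_ hK
  refine (LinearEquiv.ofInjective (e.symm.toLinearMap ∘ₗ i)
    (e.symm.injective.comp hi)).trans (LinearEquiv.ofEq _ _ ?_)
  ext x
  simp only [LinearMap.mem_range, LinearMap.mem_ker, LinearMap.comp_apply, LinearEquiv.coe_coe]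
  rw [hif (e x)]
  simp [Set.mem_range, LinearEquiv.symm_apply_eq]

theorem HasTypeFP.prod {n : ℕ} {M N : Type} [AddCommGroup M] [Module A M] [AddCommGroup N]
    [Module A N] (hM : HasTypeFP (A := A) n M) (hN : HasTypeFP (A := A) n N) :
    HasTypeFP (A := A) n (M × N) := by
  induction n generalizing M N with
  | zero =>
    have : Module.Finite A M := hM
    have : Module.Finite A N := hN
    exact (inferInstance : Module.Finite A (M × N))
  | succ n ih =>
    obtain ⟨p, f, hf, hkf⟩ := hM
    obtain ⟨q, g, hg, hkg⟩ := hN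
    obtain ⟨e⟩ := exists_equiv_fin_prod (A := A) p q
    refine HasTypeFP.of_exact e
      ((LinearMap.ker f).subtype.prodMap (LinearMap.ker g).subtype) (f.prodMap g)
      (Subtype.val_injective.prodMap Subtype.val_injective) ?_ (hf.prodMap hg) (ih hkf hkg)
    rintro ⟨x, y⟩
    simp [Set.mem_range]

/-- Finitely generated projective modules are of type `FP_n` for all `n`. -/
theorem HasTypeFP.of_projective (n : ℕ) (P : Type) [AddCommGroup P] [Module A P]
    [Module.Finite A P] [Module.Projective A P] : HasTypeFP (A := A) n P := by
  induction n generalizing P with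
  | zero => exact (inferInstance : Module.Finite A P)
  | succ n ih =>
    obtain ⟨m, f, hf⟩ := Module.Finite.exists_fin' A P
    obtain ⟨e⟩ := nonempty_equiv_ker_prod f hf
    have hsurj : Function.Surjective (LinearMap.fst A (LinearMap.ker f) P ∘ₗ e.toLinearMap) :=
      Prod.fst_surjective.comp e.surjective
    have : Module.Finite A (LinearMap.ker f) := Module.Finite.of_surjective _ hsurj
    have : Module.Projective A (LinearMap.ker f) :=
      Module.Projective.of_split (e.symm.toLinearMap ∘ₗ LinearMap.inl A _ P)
        (LinearMap.fst A (LinearMap.ker f) P ∘ₗ e.toLinearMap) (by ext x; simp)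
    exact ⟨m, f, hf, ih _⟩

/-- In the inductive step in the definition of `HasTypeFP`, finitely generated projective modules
may replace free modules. -/
theorem HasTypeFP.of_exact_projective {n : ℕ} {K P M : Type} [AddCommGroup K] [Module A K]
    [AddCommGroup P] [Module A P] [AddCommGroup M] [Module A M] [Module.Finite A P]
    [Module.Projective A P] (i : K →ₗ[A] P) (f : P →ₗ[A] M) (hi : Function.Injective i)
    (hif : Function.Exact i f) (hf : Function.Surjective f) (hK : HasTypeFP (A := A) n K) :
    HasTypeFP (A := A) (n + 1) M := by
  obtain ⟨m, g, hg⟩ := Module.Finite.exists_fin' A P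
  obtain ⟨e⟩ := nonempty_equiv_ker_prod g hg
  have hsurj : Function.Surjective (LinearMap.fst A (LinearMap.ker g) P ∘ₗ e.toLinearMap) :=
    Prod.fst_surjective.comp e.surjective
  have : Module.Finite A (LinearMap.ker g) := Module.Finite.of_surjective _ hsurj
  have : Module.Projective A (LinearMap.ker g) :=
    Module.Projective.of_split (e.symm.toLinearMap ∘ₗ LinearMap.inl A _ P)
      (LinearMap.fst A (LinearMap.ker g) P ∘ₗ e.toLinearMap) (by ext x; simp)
  refine HasTypeFP.of_exact e (LinearMap.id.prodMap i)
    (f ∘ₗ LinearMap.snd A (LinearMap.ker g) P) (Function.injective_id.prodMap hi) ?_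
    (hf.comp Prod.snd_surjective) ((HasTypeFP.of_projective n (LinearMap.ker g)).prod hK)
  rintro ⟨x, y⟩
  simpa [Set.mem_range] using hif y

/-- A direct complement of a finitely generated free module in a module of type `FP_n` is of type
`FP_n`. -/
theorem HasTypeFP.of_prod_free {n p : ℕ} {K : Type} [AddCommGroup K] [Module A K]
    (h : HasTypeFP (A := A) n (K × (Fin p → A))) : HasTypeFP (A := A) n K := by
  cases n with
  | zero =>
    have : Module.Finite A (K × (Fin p → A)) := h
    exact Module.Finite.of_surjective (LinearMap.fst A K (Fin p → A)) Prod.fst_surjective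
  | succ n =>
    obtain ⟨m, f, hf, hk⟩ := h
    refine ⟨m, LinearMap.fst A K _ ∘ₗ f, Prod.fst_surjective.comp hf, ?_⟩
    -- The kernel `L` of the composition surjects onto the free summand with kernel `ker f`.
    let L := LinearMap.ker (LinearMap.fst A K (Fin p → A) ∘ₗ f)
    let g : L →ₗ[A] (Fin p → A) := LinearMap.snd A K _ ∘ₗ f ∘ₗ L.subtype
    have hL : ∀ x : L, (f x).1 = 0 := fun x => x.2
    have hg : Function.Surjective g := fun y => by
      obtain ⟨x, hx⟩ := hf (0, y)
      exact ⟨⟨x, by simp [L, hx]⟩, by simp [g, hx]⟩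
    obtain ⟨e⟩ := nonempty_equiv_ker_prod g hg
    have hle : LinearMap.ker f ≤ L := fun x hx => by
      have : f x = 0 := hx
      simp [L, this]
    refine HasTypeFP.congr (M := LinearMap.ker g × (Fin p → A)) (M' := L) e.symm
      (HasTypeFP.prod (HasTypeFP.congr ?_ hk) (HasTypeFP.of_projective n _))
    refine (LinearEquiv.ofInjective ((Submodule.inclusion hle).codRestrict (LinearMap.ker g) ?_)
      ?_).trans (LinearEquiv.ofTop _ ?_)
    · intro x
      have : f x = 0 := x.2
      simp [g, this]
    · intro x y hxy
      have := congrArg (fun z : LinearMap.ker g => z.1.1) hxy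
      exact Subtype.ext this
    · rw [LinearMap.range_eq_top]
      rintro ⟨x, hx⟩
      have hx' : (f x).2 = 0 := hx
      exact ⟨⟨x, Prod.ext (hL x) hx'⟩, rfl⟩

/-- Schanuel's lemma: the kernels of two surjections from free modules onto the same module become
isomorphic after adding free modules. -/
theorem nonempty_schanuel_equiv {p q : ℕ} {M : Type} [AddCommGroup M] [Module A M]
    (f : (Fin p → A) →ₗ[A] M) (g : (Fin q → A) →ₗ[A] M) (hf : Function.Surjective f)
    (hg : Function.Surjective g) :
    Nonempty ((LinearMap.ker f × (Fin q → A)) ≃ₗ[A] LinearMap.ker g × (Fin p → A)) := by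
  -- Both sides are the fibre product `Q` of `f` and `g`.
  let Q := LinearMap.eqLocus (f ∘ₗ LinearMap.fst A _ (Fin q → A))
    (g ∘ₗ LinearMap.snd A (Fin p → A) _)
  have hQ : ∀ x : Q, f x.1.1 = g x.1.2 := fun x => x.2
  let π₁ : Q →ₗ[A] (Fin p → A) := LinearMap.fst A _ _ ∘ₗ Q.subtype
  let π₂ : Q →ₗ[A] (Fin q → A) := LinearMap.snd A _ _ ∘ₗ Q.subtype
  have h₁ : Function.Surjective π₁ := fun x => by
    obtain ⟨y, hy⟩ := hg (f x)
    exact ⟨⟨(x, y), hy.symm⟩, rfl⟩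
  have h₂ : Function.Surjective π₂ := fun y => by
    obtain ⟨x, hx⟩ := hf (g y)
    exact ⟨⟨(x, y), hx⟩, rfl⟩
  have k₂ : ∀ z : LinearMap.ker π₂, z.1.1.2 = 0 := fun z => z.2
  have k₁ : ∀ z : LinearMap.ker π₁, z.1.1.1 = 0 := fun z => z.2
  obtain ⟨e₁⟩ := nonempty_equiv_ker_prod π₁ h₁
  obtain ⟨e₂⟩ := nonempty_equiv_ker_prod π₂ h₂
  have E₂ : LinearMap.ker π₂ ≃ₗ[A] LinearMap.ker f := by
    refine LinearEquiv.ofBijective ((π₁ ∘ₗ (LinearMap.ker π₂).subtype).codRestrict _ ?_) ⟨?_, ?_⟩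
    · intro z
      exact (hQ z.1).trans (by rw [k₂ z, map_zero])
    · intro z w hzw
      have : z.1.1.1 = w.1.1.1 := congrArg Subtype.val hzw
      exact Subtype.ext (Subtype.ext (Prod.ext this ((k₂ z).trans (k₂ w).symm)))
    · rintro ⟨x, hx⟩
      have hx' : f x = 0 := hx
      exact ⟨⟨⟨(x, 0), by simp [Q, hx']⟩, rfl⟩, rfl⟩
  have E₁ : LinearMap.ker π₁ ≃ₗ[A] LinearMap.ker g := by
    refine LinearEquiv.ofBijective ((π₂ ∘ₗ (LinearMap.ker π₁).subtype).codRestrict _ ?_) ⟨?_, ?_⟩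
    · intro z
      exact (hQ z.1).symm.trans (by rw [k₁ z, map_zero])
    · intro z w hzw
      have : z.1.1.2 = w.1.1.2 := congrArg Subtype.val hzw
      exact Subtype.ext (Subtype.ext (Prod.ext ((k₁ z).trans (k₁ w).symm) this))
    · rintro ⟨x, hx⟩
      have hx' : g x = 0 := hx
      exact ⟨⟨⟨(0, x), by simp [Q, hx']⟩, rfl⟩, rfl⟩
  exact ⟨(E₂.prodCongr (LinearEquiv.refl A _)).symm.trans (e₂.symm.trans (e₁.trans
    (E₁.prodCongr (LinearEquiv.refl A _))))⟩

/-- The kernel of any surjection of a finitely generated based free module onto a module of type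
`FP_{n+1}` is of type `FP_n`. -/
theorem HasTypeFP.ker {n p : ℕ} {M : Type} [AddCommGroup M] [Module A M]
    (h : HasTypeFP (A := A) (n + 1) M) (f : (Fin p → A) →ₗ[A] M) (hf : Function.Surjective f) :
    HasTypeFP (A := A) n (LinearMap.ker f) := by
  obtain ⟨q, g, hg, hk⟩ := h
  obtain ⟨e⟩ := nonempty_schanuel_equiv f g hf hg
  exact HasTypeFP.of_prod_free
    (HasTypeFP.congr e.symm (hk.prod (HasTypeFP.of_projective n _)))

open CategoryTheory in
theorem hasTypeFP_of_projectiveResolution (n : ℕ) (M : Type) [AddCommGroup M] [Module A M]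
    (P : ProjectiveResolution (ModuleCat.of A M))
    (hP : ∀ i ≤ n, Module.Finite A (P.complex.X i)) : HasTypeFP (A := A) n M := by
  have hproj : ∀ i, Module.Projective A (P.complex.X i) := fun i =>
    (IsProjective.iff_projective _).2 (P.projective i)
  have hsucc : ∀ i, Function.Exact (P.complex.d (i + 2) (i + 1)) (P.complex.d (i + 1) i) :=
    fun i => (ShortComplex.ShortExact.moduleCat_exact_iff_function_exact _).1 (P.exact_succ i)
  -- The syzygies, that is the images of the differentials, have the finiteness property.
  have hsyz : ∀ t i : ℕ, i + 1 + t ≤ n →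
      HasTypeFP (A := A) t (LinearMap.range (P.complex.d (i + 1) i).hom) := by
    intro t
    induction t with
    | zero =>
      intro i hi
      have := hP (i + 1) hi
      exact Module.Finite.range _
    | succ t ih =>
      intro i hi
      have := hP (i + 1) (by omega)
      have := hproj (i + 1)
      refine HasTypeFP.of_exact_projective
        (LinearMap.range (P.complex.d (i + 2) (i + 1)).hom).subtype
        (P.complex.d (i + 1) i).hom.rangeRestrict Subtype.val_injective ?_
        (LinearMap.surjective_rangeRestrict _) (ih (i + 1) (by omega))
      intro x
      have := hsucc i x
      simp only [Submodule.coe_subtype, Subtype.range_coe_subtype]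
      rw [← Subtype.coe_inj]
      exact this
  have hπ : Function.Surjective (P.π.f 0).hom := (ModuleCat.epi_iff_surjective _).1 inferInstance
  have hex : Function.Exact (P.complex.d 1 0).hom (P.π.f 0).hom :=
    (ShortComplex.ShortExact.moduleCat_exact_iff_function_exact _).1 P.exact₀
  have := hP 0 (by omega)
  have := hproj 0
  cases n with
  | zero => exact Module.Finite.of_surjective (M := P.complex.X 0) (P := M) (P.π.f 0).hom hπ
  | succ n =>
    refine HasTypeFP.of_exact_projective (P := P.complex.X 0) (M := M)
      (LinearMap.range (P.complex.d 1 0).hom).subtype (P.π.f 0).hom Subtype.val_injective ?_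
      hπ (hsyz n 0 (by omega))
    intro x
    have := hex x
    simp only [Submodule.coe_subtype, Subtype.range_coe_subtype]
    exact this

variable (A) in
/-- A submodule of a finitely generated based free module which is of type `FP_n` for all `n`. -/
structure Syzygy where
  /-- the rank of the free module -/
  rank : ℕ
  /-- the submodule -/
  carrier : Submodule A (Fin rank → A)
  hasTypeFP : ∀ n, HasTypeFP (A := A) n carrier

theorem Syzygy.exists_next (S : Syzygy A) : ∃ (T : Syzygy A)
    (d : (Fin T.rank → A) →ₗ[A] (Fin S.rank → A)),
      LinearMap.range d = S.carrier ∧ LinearMap.ker d = T.carrier := by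
  have := (S.hasTypeFP 0).finite
  obtain ⟨m, f, hf⟩ := Module.Finite.exists_fin' A S.carrier
  refine ⟨⟨m, LinearMap.ker f, fun n => (S.hasTypeFP (n + 1)).ker f hf⟩,
    S.carrier.subtype ∘ₗ f, ?_, ?_⟩
  · rw [LinearMap.range_comp, LinearMap.range_eq_top.2 hf, Submodule.map_subtype_top]
  · rw [LinearMap.ker_comp, Submodule.ker_subtype, Submodule.comap_bot]

/-- A chosen successor of a syzygy module: the kernel of a surjection of a free module onto it. -/
noncomputable def Syzygy.next (S : Syzygy A) : Syzygy A := S.exists_next.choose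

end Finiteness

/-- The augmentation of `ℚΓ`, on the based free module of rank one. -/
noncomputable def standardAugmentation (Γ : Type) [Group Γ] :
    (Fin 1 → MonoidAlgebra ℚ Γ) →ₗ[MonoidAlgebra ℚ Γ] TrivialQ Γ :=
  (LinearMap.toSpanSingleton _ (TrivialQ Γ)
    ((Representation.trivial ℚ Γ ℚ).asModuleEquiv.symm 1)) ∘ₗ LinearMap.proj 0

theorem standardAugmentation_surjective (Γ : Type) [Group Γ] :
    Function.Surjective (standardAugmentation Γ) := by
  intro q
  refine ⟨fun _ => MonoidAlgebra.single 1 ((Representation.trivial ℚ Γ ℚ).asModuleEquiv q), ?_⟩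
  apply (Representation.trivial ℚ Γ ℚ).asModuleEquiv.injective
  simp [standardAugmentation]
  rfl

/-- Iterated free covers of syzygies resolve the trivial module. -/
theorem nonempty_basedResolution {Γ : Type} [Group Γ] (h : IsFPInfty Γ) :
    Nonempty (BasedResolution Γ) := by
  have hQ : ∀ n, HasTypeFP (A := MonoidAlgebra ℚ Γ) n (TrivialQ Γ) := fun n => by
    obtain ⟨P, hP⟩ := h n
    exact hasTypeFP_of_projectiveResolution n _ P hP
  let S₀ : Syzygy (MonoidAlgebra ℚ Γ) :=
    ⟨1, LinearMap.ker (standardAugmentation Γ), fun n =>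
      (hQ (n + 1)).ker _ (standardAugmentation_surjective Γ)⟩
  let S : ℕ → Syzygy (MonoidAlgebra ℚ Γ) := fun n => Nat.rec S₀ (fun _ T => T.next) n
  have hS : ∀ k, ∃ d : (Fin (S (k + 1)).rank → MonoidAlgebra ℚ Γ) →ₗ[MonoidAlgebra ℚ Γ]
      (Fin (S k).rank → MonoidAlgebra ℚ Γ),
      LinearMap.range d = (S k).carrier ∧ LinearMap.ker d = (S (k + 1)).carrier :=
    fun k => (S k).exists_next.choose_spec
  choose d hd using hS
  exact ⟨{
    rank := fun k => (S k).rank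
    rank_zero := rfl
    d := d
    aug := standardAugmentation Γ
    aug_surjective := standardAugmentation_surjective Γ
    exact_zero := LinearMap.exact_iff.2 (hd 0).1.symm
    exact_succ := fun k => LinearMap.exact_iff.2 ((hd k).2.trans (hd (k + 1)).1.symm) }⟩

end HigherT

/-! ### Matrices of the complexified resolution -/

namespace HigherT

noncomputable section

section GroupRing

variable {Γ : Type} [Group Γ]

theorem star_smul_groupRing (c : ℂ) (x : MonoidAlgebra ℂ Γ) :
    star (c • x) = starRingEnd ℂ c • star x := by
  induction x using MonoidAlgebra.induction_linear with
  | zero => simp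
  | add f g hf hg => rw [smul_add, star_add, hf, hg, star_add, smul_add]
  | single γ a => simp [star_single]

instance : StarModule ℂ (MonoidAlgebra ℂ Γ) := ⟨star_smul_groupRing⟩

/-- The inclusion of `ℚΓ` into `ℂΓ`. -/
abbrev complexify : MonoidAlgebra ℚ Γ →+* MonoidAlgebra ℂ Γ :=
  MonoidAlgebra.mapRingHom Γ (algebraMap ℚ ℂ)

/-- The coordinate map `ℂΓ → ℚΓ` of an additive functional on the coefficients, for instance of a
coordinate with respect to a `ℚ`-basis of `ℂ`, is `ℚΓ`-linear on the right. -/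
theorem map_mul_complexify (f : ℂ →ₗ[ℚ] ℚ) (x : MonoidAlgebra ℂ Γ) (y : MonoidAlgebra ℚ Γ) :
    MonoidAlgebra.map (f : ℂ →+ ℚ) (x * complexify y) =
      MonoidAlgebra.map (f : ℂ →+ ℚ) x * y := by
  induction x using MonoidAlgebra.induction_linear with
  | zero => simp
  | add x₁ x₂ h₁ h₂ => rw [add_mul, MonoidAlgebra.map_add, h₁, h₂, MonoidAlgebra.map_add, add_mul]
  | single γ a =>
    induction y using MonoidAlgebra.induction_linear with
    | zero => simp
    | add x₁ x₂ h₁ h₂ => rw [map_add, mul_add, MonoidAlgebra.map_add, h₁, h₂, mul_add]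
    | single δ q =>
      have h : f (a * (q : ℂ)) = f a * q := by
        rw [mul_comm, mul_comm (f a), ← smul_eq_mul q, ← f.map_smul, Rat.smul_def]
      simp [MonoidAlgebra.single_mul_single, h]

/-- An element of `ℂΓ` is the combination of its coordinates with respect to a `ℚ`-basis of
`ℂ`. -/
theorem sum_basis_mul_complexify {ι : Type} (b : Module.Basis ι ℚ ℂ) (x : MonoidAlgebra ℂ Γ)
    (s : Finset ι) (hs : ∀ γ, (b.repr (x.coeff γ)).support ⊆ s) :
    ∑ β ∈ s, b β • complexify (MonoidAlgebra.map (b.coord β : ℂ →+ ℚ) x) = x := by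
  ext γ
  conv_rhs => rw [← b.linearCombination_repr (x.coeff γ), Finsupp.linearCombination_apply,
    Finsupp.sum_of_support_subset _ (hs γ) _ (by simp)]
  rw [MonoidAlgebra.coeff_sum, Finsupp.finsetSum_apply]
  refine Finset.sum_congr rfl fun β _ => ?_
  simp [Rat.smul_def, mul_comm]

/-- Extension of scalars from `ℚ` to `ℂ` preserves exactness. -/
theorem exists_eq_vecMul_map_complexify {p q r : ℕ}
    (M : Matrix (Fin p) (Fin q) (MonoidAlgebra ℚ Γ)) (N : Matrix (Fin q) (Fin r) (MonoidAlgebra ℚ Γ))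
    (h : ∀ x, x ᵥ* N = 0 → ∃ y, x = y ᵥ* M) (x : Fin q → MonoidAlgebra ℂ Γ)
    (hx : x ᵥ* N.map complexify = 0) : ∃ y, x = y ᵥ* M.map complexify := by
  classical
  let b := Module.Basis.ofVectorSpace ℚ ℂ
  let c := fun β (z : MonoidAlgebra ℂ Γ) => MonoidAlgebra.map (b.coord β : ℂ →+ ℚ) z
  have hc : ∀ β, (fun i => c β (x i)) ᵥ* N = 0 := fun β => by
    ext1 j
    have := congrArg (c β) (congrFun hx j)
    simp only [Matrix.vecMul, dotProduct, Matrix.map_apply, Pi.zero_apply, c,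
      MonoidAlgebra.map_sum, map_mul_complexify, MonoidAlgebra.map_zero] at this
    exact this
  choose y hy using fun β => h _ (hc β)
  let s : Finset _ := Finset.univ.biUnion fun i =>
    (x i).coeff.support.biUnion fun γ => (b.repr ((x i).coeff γ)).support
  have hs : ∀ i γ, (b.repr ((x i).coeff γ)).support ⊆ s := fun i γ => by
    by_cases hγ : (x i).coeff γ = 0
    · simp [hγ]
    · refine Finset.Subset.trans ?_ (Finset.subset_biUnion_of_mem _ (Finset.mem_univ i))
      exact Finset.subset_biUnion_of_mem (fun γ => (b.repr ((x i).coeff γ)).support)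
        (Finsupp.mem_support_iff.2 hγ)
  refine ⟨∑ β ∈ s, b β • fun i => complexify (y β i), ?_⟩
  ext1 i
  rw [← sum_basis_mul_complexify b (x i) s (hs i), Matrix.sum_vecMul, Finset.sum_apply]
  refine Finset.sum_congr rfl fun β _ => ?_
  have := congrFun (hy β) i
  simp only [c] at this
  rw [this, Matrix.smul_vecMul, Pi.smul_apply]
  simp [Matrix.vecMul, dotProduct]

end GroupRing

namespace BasedResolution

variable {Γ : Type} [Group Γ] (R : BasedResolution Γ)

/-- The matrix over `ℚΓ` of the differential from degree `k + 1` to degree `k`. -/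
def matQ (k : ℕ) : Matrix (Fin (R.rank (k + 1))) (Fin (R.rank k)) (MonoidAlgebra ℚ Γ) :=
  LinearMap.toMatrixRight' (R.d k)

/-- The matrix over `ℂΓ` of the differential from degree `k + 1` to degree `k`. -/
def mat (k : ℕ) : Matrix (Fin (R.rank (k + 1))) (Fin (R.rank k)) (MonoidAlgebra ℂ Γ) :=
  (R.matQ k).map complexify

theorem d_apply (k : ℕ) (x) : R.d k x = x ᵥ* R.matQ k := by
  rw [← Matrix.toLinearMapRight'_apply]
  simp [matQ]

theorem dC_eq (k : ℕ) : R.dC k = Matrix.toLinearMapRight' (R.mat k) := rfl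

theorem formalAdjoint_dC (k : ℕ) :
    formalAdjoint (R.dC k) = Matrix.toLinearMapRight' (R.mat k)ᴴ := by
  rw [dC_eq, formalAdjoint, LinearEquiv.apply_symm_apply]

theorem laplacian_zero : R.laplacian 0 = (R.mat 0)ᴴ * R.mat 0 := by
  rw [laplacian, laplaceOperator, formalAdjoint_dC, dC_eq, LinearMap.toMatrixRight'_comp]
  simp

theorem laplacian_succ (k : ℕ) : R.laplacian (k + 1) =
    R.mat k * (R.mat k)ᴴ + (R.mat (k + 1))ᴴ * R.mat (k + 1) := by
  rw [laplacian, laplaceOperator, formalAdjoint_dC, formalAdjoint_dC, dC_eq, dC_eq, map_add,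
    LinearMap.toMatrixRight'_comp, LinearMap.toMatrixRight'_comp]
  simp

/-- The index of the basis vector in degree `0`. -/
def idx : Fin (R.rank 0) := ⟨0, by simp [R.rank_zero]⟩

instance : Subsingleton (Fin (R.rank 0)) := by
  rw [R.rank_zero]; infer_instance

instance : Unique (Fin (R.rank 0)) := ⟨⟨R.idx⟩, fun _ => Subsingleton.elim _ _⟩

/-- The coefficients of the differential from degree `1` to degree `0`. They generate the
augmentation ideal. -/
def gen (i : Fin (R.rank 1)) : MonoidAlgebra ℂ Γ := R.mat 0 i R.idx

theorem laplacianZero_eq : R.laplacianZero = ∑ i, star (R.gen i) * R.gen i := by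
  change R.laplacian 0 R.idx R.idx = _
  rw [laplacian_zero, Matrix.mul_apply]
  rfl

/-- The augmentation ideal of `ℂΓ`, as the left ideal generated by the coefficients of the first
differential. -/
def augIdeal : Submodule (MonoidAlgebra ℂ Γ) (MonoidAlgebra ℂ Γ) :=
  Submodule.span _ (Set.range R.gen)

theorem exists_eq_vecMul_mat (k : ℕ) (x : R.P (k + 1)) (hx : x ᵥ* R.mat k = 0) :
    ∃ y, x = y ᵥ* R.mat (k + 1) := by
  refine exists_eq_vecMul_map_complexify _ _ (fun x hx => ?_) x hx
  rw [← d_apply] at hx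
  obtain ⟨y, hy⟩ := (R.exact_succ k x).1 hx
  exact ⟨y, by rw [← hy, d_apply]⟩

theorem mat_mul_mat (k : ℕ) : R.mat (k + 1) * R.mat k = 0 := by
  have h : R.matQ (k + 1) * R.matQ k = 0 := by
    rw [matQ, matQ, ← LinearMap.toMatrixRight'_comp, (R.exact_succ k).linearMap_comp_eq_zero,
      map_zero]
  rw [mat, mat, ← Matrix.map_mul, h]
  simp

theorem aug_eq (x : Fin (R.rank 0) → MonoidAlgebra ℚ Γ) :
    R.aug x = x R.idx • R.aug (Pi.single R.idx 1) := by
  rw [← map_smul]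
  congr 1
  ext1 i
  obtain rfl : i = R.idx := Subsingleton.elim _ _
  simp

theorem aug_single_ne_zero : R.aug (Pi.single R.idx 1) ≠ 0 := by
  intro h
  obtain ⟨x, hx⟩ := R.aug_surjective ((Representation.trivial ℚ Γ ℚ).asModuleEquiv.symm 1)
  rw [aug_eq, h, smul_zero, eq_comm, LinearEquiv.map_eq_zero_iff] at hx
  exact one_ne_zero hx

/-- The coefficients of the first differential have augmentation zero. -/
theorem sum_coeff_gen (i : Fin (R.rank 1)) :
    MonoidAlgebra.lift ℂ ℂ Γ 1 (R.gen i) = 0 := by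
  have h₀ : R.aug (R.matQ 0 i) = 0 := by
    have := (R.exact_zero.apply_apply_eq_zero (Pi.single i 1))
    rwa [d_apply, Matrix.single_one_vecMul] at this
  rw [aug_eq] at h₀
  have h₁ : MonoidAlgebra.lift ℚ ℚ Γ 1 (R.matQ 0 i R.idx) = 0 := by
    have hs : ∀ (a : MonoidAlgebra ℚ Γ) (q : TrivialQ Γ),
        (Representation.trivial ℚ Γ ℚ).asModuleEquiv (a • q) =
          MonoidAlgebra.lift ℚ ℚ Γ 1 a * (Representation.trivial ℚ Γ ℚ).asModuleEquiv q := by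
      intro a q
      rw [Representation.asModuleEquiv_map_smul]
      induction a using MonoidAlgebra.induction_linear with
      | zero => simp
      | add a b ha hb => simp [ha, hb, add_mul]
      | single γ a => simp [Representation.asAlgebraHom_single]
    have := congrArg (Representation.trivial ℚ Γ ℚ).asModuleEquiv h₀
    rw [hs, map_zero] at this
    refine (mul_eq_zero.1 this).resolve_right fun h => R.aug_single_ne_zero ?_
    exact (LinearEquiv.map_eq_zero_iff _).1 h
  have h₂ : ∀ a : MonoidAlgebra ℚ Γ, MonoidAlgebra.lift ℂ ℂ Γ 1 (complexify a) =
      algebraMap ℚ ℂ (MonoidAlgebra.lift ℚ ℚ Γ 1 a) := by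
    intro a
    induction a using MonoidAlgebra.induction_linear with
    | zero => simp
    | add a b ha hb => simp only [map_add, ha, hb]
    | single γ a => simp
  exact (h₂ _).trans (by rw [h₁, map_zero])

theorem single_sub_one_mem_augIdeal (γ : Γ) :
    MonoidAlgebra.single γ 1 - 1 ∈ R.augIdeal := by
  have h : R.aug (fun _ => MonoidAlgebra.single γ 1 - 1) = 0 := by
    rw [aug_eq, sub_smul, one_smul, sub_eq_zero]
    apply (Representation.trivial ℚ Γ ℚ).asModuleEquiv.injective
    rw [Representation.asModuleEquiv_map_smul, Representation.asAlgebraHom_single]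
    simp
  obtain ⟨y, hy⟩ := (R.exact_zero _).1 h
  rw [d_apply] at hy
  have := congrArg complexify (congrFun hy R.idx)
  simp only [Matrix.vecMul, dotProduct, map_sum, map_mul, map_sub, map_one] at this
  rw [MonoidAlgebra.mapRingHom_single, map_one] at this
  rw [← this]
  exact Submodule.sum_mem _ fun i _ =>
    Submodule.smul_mem _ (complexify (y i)) (Submodule.subset_span ⟨i, rfl⟩)

theorem gen_mem_augIdeal (i : Fin (R.rank 1)) : R.gen i ∈ R.augIdeal :=
  Submodule.subset_span ⟨i, rfl⟩

theorem laplacianZero_mem_augIdeal : R.laplacianZero ∈ R.augIdeal := by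
  rw [laplacianZero_eq]
  exact Submodule.sum_mem _ fun i _ => Submodule.smul_mem _ _ (R.gen_mem_augIdeal i)

theorem star_laplacianZero : star R.laplacianZero = R.laplacianZero := by
  simp [laplacianZero_eq]

end BasedResolution

end

end HigherT

/-! ### Group cohomology from the based resolution -/

namespace HigherT

noncomputable section

section MatrixAction

variable {Γ : Type} [Group Γ] {V : Type} [AddCommGroup V] [Module ℂ V] (π : Representation ℂ Γ V)
variable {p q r : ℕ}

/-- The action of a `p × q`-matrix over `ℂΓ` on tuples of vectors of a representation. The map
`Hom_{ℂΓ}((ℂΓ)^q, V) → Hom_{ℂΓ}((ℂΓ)^p, V)` induced by the matrix takes this form if homomorphisms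
are identified with the tuples of values on the standard basis. -/
def matAct (M : Matrix (Fin p) (Fin q) (MonoidAlgebra ℂ Γ)) : (Fin q → V) →ₗ[ℂ] (Fin p → V) :=
  LinearMap.pi fun i => ∑ j, π.asAlgebraHom (M i j) ∘ₗ LinearMap.proj j

theorem matAct_apply (M : Matrix (Fin p) (Fin q) (MonoidAlgebra ℂ Γ)) (v : Fin q → V) (i : Fin p) :
    matAct π M v i = ∑ j, π.asAlgebraHom (M i j) (v j) := by
  simp [matAct]

theorem matAct_add (M N : Matrix (Fin p) (Fin q) (MonoidAlgebra ℂ Γ)) (v : Fin q → V) :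
    matAct π (M + N) v = matAct π M v + matAct π N v := by
  ext1 i
  simp [matAct_apply, Finset.sum_add_distrib]

theorem matAct_mul (M : Matrix (Fin p) (Fin q) (MonoidAlgebra ℂ Γ))
    (N : Matrix (Fin q) (Fin r) (MonoidAlgebra ℂ Γ)) (v : Fin r → V) :
    matAct π (M * N) v = matAct π M (matAct π N v) := by
  ext1 i
  simp only [matAct_apply, Matrix.mul_apply, map_sum, map_mul, LinearMap.sum_apply,
    Module.End.mul_apply]
  exact Finset.sum_comm

end MatrixAction

section FreeRep

variable (Γ : Type) [Group Γ]

/-- The based free `ℂΓ`-module of rank `m` as a representation. -/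
def freeRepresentation (m : ℕ) : Representation ℂ Γ (Fin m → MonoidAlgebra ℂ Γ) where
  toFun γ :=
    { toFun := fun x => MonoidAlgebra.single γ (1 : ℂ) • x
      map_add' := fun x y => smul_add _ x y
      map_smul' := fun c x => by ext1 i; simp }
  map_one' := by
    refine LinearMap.ext fun x => ?_
    change MonoidAlgebra.single (1 : Γ) (1 : ℂ) • x = _
    rw [← MonoidAlgebra.one_def, one_smul]
    rfl
  map_mul' γ δ := by
    refine LinearMap.ext fun x => ?_
    change MonoidAlgebra.single (γ * δ) (1 : ℂ) • x =
      MonoidAlgebra.single γ (1 : ℂ) • MonoidAlgebra.single δ (1 : ℂ) • x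
    rw [smul_smul, MonoidAlgebra.single_mul_single, one_mul]

variable {Γ}

theorem freeRepresentation_apply (m : ℕ) (γ : Γ) (x : Fin m → MonoidAlgebra ℂ Γ) :
    freeRepresentation Γ m γ x = MonoidAlgebra.single γ (1 : ℂ) • x := rfl

theorem freeRepresentation_asAlgebraHom (m : ℕ) (a : MonoidAlgebra ℂ Γ)
    (x : Fin m → MonoidAlgebra ℂ Γ) : (freeRepresentation Γ m).asAlgebraHom a x = a • x := by
  induction a using MonoidAlgebra.induction_linear with
  | zero => simp
  | add a b ha hb => simp [ha, hb, add_smul]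
  | single γ c =>
    rw [Representation.asAlgebraHom_single, LinearMap.smul_apply, freeRepresentation_apply,
      ← smul_assoc, MonoidAlgebra.smul_single, smul_eq_mul, mul_one]

/-- The homomorphism from a based free module with prescribed values on the basis. -/
def freeLift {m : ℕ} {V : Type} [AddCommGroup V] [Module ℂ V] (π : Representation ℂ Γ V)
    (v : Fin m → V) : (freeRepresentation Γ m).IntertwiningMap π where
  toFun x := ∑ i, π.asAlgebraHom (x i) (v i)
  map_add' x y := by simp [Finset.sum_add_distrib]
  map_smul' c x := by simp [Finset.smul_sum]
  isIntertwining' γ := by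
    refine LinearMap.ext fun x => ?_
    simp [freeRepresentation_apply, Representation.asAlgebraHom_single]

theorem freeLift_apply {m : ℕ} {V : Type} [AddCommGroup V] [Module ℂ V]
    (π : Representation ℂ Γ V) (v : Fin m → V) (x : Fin m → MonoidAlgebra ℂ Γ) :
    freeLift π v x = ∑ i, π.asAlgebraHom (x i) (v i) := rfl

theorem intertwiningMap_asAlgebraHom {V W : Type} [AddCommGroup V] [Module ℂ V] [AddCommGroup W]
    [Module ℂ W] {π : Representation ℂ Γ V} {σ : Representation ℂ Γ W}
    (f : π.IntertwiningMap σ) (a : MonoidAlgebra ℂ Γ) (v : V) :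
    f (π.asAlgebraHom a v) = σ.asAlgebraHom a (f v) := by
  induction a using MonoidAlgebra.induction_linear with
  | zero => simp
  | add a b ha hb => simp [ha, hb]
  | single γ c => simp [Representation.asAlgebraHom_single, f.isIntertwining]

theorem eq_freeLift {m : ℕ} {V : Type} [AddCommGroup V] [Module ℂ V] {π : Representation ℂ Γ V}
    (f : (freeRepresentation Γ m).IntertwiningMap π) :
    f = freeLift π fun i => f (Pi.single i 1) := by
  refine DFunLike.ext _ _ fun x => ?_
  rw [freeLift_apply]
  simp_rw [← intertwiningMap_asAlgebraHom, freeRepresentation_asAlgebraHom, ← map_sum]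
  congr 1
  ext1 j
  simp [Finset.sum_apply, Pi.single_apply]

theorem freeLift_single {m : ℕ} {V : Type} [AddCommGroup V] [Module ℂ V]
    (π : Representation ℂ Γ V) (v : Fin m → V) (j : Fin m) :
    freeLift π v (Pi.single j 1) = v j := by
  rw [freeLift_apply, Finset.sum_eq_single j]
  · simp
  · intro i _ hi
    simp [Pi.single_eq_of_ne hi]
  · simp

theorem freeLift_zero {m : ℕ} {V : Type} [AddCommGroup V] [Module ℂ V]
    (π : Representation ℂ Γ V) : freeLift (m := m) π 0 = 0 := by
  refine DFunLike.ext _ _ fun x => ?_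
  rw [freeLift_apply]
  simp

/-- The homomorphism of based free modules given by a matrix. -/
def freeMap {p q : ℕ} (M : Matrix (Fin p) (Fin q) (MonoidAlgebra ℂ Γ)) :
    (freeRepresentation Γ p).IntertwiningMap (freeRepresentation Γ q) :=
  freeLift _ fun i => M i

theorem freeMap_apply {p q : ℕ} (M : Matrix (Fin p) (Fin q) (MonoidAlgebra ℂ Γ))
    (x : Fin p → MonoidAlgebra ℂ Γ) : freeMap M x = x ᵥ* M := by
  rw [freeMap, freeLift_apply, Matrix.vecMul_eq_sum]
  simp only [freeRepresentation_asAlgebraHom]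

theorem freeLift_comp_freeMap {p q : ℕ} {V : Type} [AddCommGroup V] [Module ℂ V]
    (π : Representation ℂ Γ V) (M : Matrix (Fin p) (Fin q) (MonoidAlgebra ℂ Γ)) (v : Fin q → V) :
    (freeLift π v).comp (freeMap M) = freeLift π (matAct π M v) := by
  rw [eq_freeLift ((freeLift π v).comp (freeMap M))]
  congr 1
  ext1 i
  change freeLift π v (freeMap M (Pi.single i 1)) = _
  rw [freeMap_apply, Matrix.single_one_vecMul, freeLift_apply, matAct_apply]
  rfl

theorem freeLift_injective {m : ℕ} {V : Type} [AddCommGroup V] [Module ℂ V]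
    (π : Representation ℂ Γ V) {v w : Fin m → V} (h : freeLift π v = freeLift π w) : v = w := by
  ext1 i
  rw [← freeLift_single π v, h, freeLift_single]

open CategoryTheory

instance projective_freeRep (m : ℕ) : Projective (Rep.of (freeRepresentation Γ m)) where
  factors {E X} f e he := by
    have he' := (Rep.epi_iff_surjective e).1 he
    choose v hv using fun i => he' (f.hom (Pi.single i 1))
    refine ⟨Rep.ofHom (freeLift E.ρ v), ?_⟩
    apply Rep.hom_ext
    change e.hom.comp (freeLift E.ρ v) = f.hom
    rw [eq_freeLift f.hom, eq_freeLift (e.hom.comp (freeLift E.ρ v))]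
    congr 1
    ext1 i
    change e.hom (freeLift E.ρ v (Pi.single i 1)) = _
    rw [freeLift_single]
    exact hv i

end FreeRep

namespace BasedResolution

open CategoryTheory

variable {Γ : Type} [Group Γ] (R : BasedResolution Γ)

theorem mem_augIdeal_iff (x : MonoidAlgebra ℂ Γ) :
    x ∈ R.augIdeal ↔ ∃ y : Fin (R.rank 1) → MonoidAlgebra ℂ Γ, ∑ i, y i * R.gen i = x :=
  Submodule.mem_span_range_iff_exists_fun _

/-- The left ideal `R.augIdeal` is the kernel of the augmentation. -/
theorem mem_augIdeal_of_augmentation (x : MonoidAlgebra ℂ Γ)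
    (hx : MonoidAlgebra.lift ℂ ℂ Γ 1 x = 0) : x ∈ R.augIdeal := by
  have h : ∀ x : MonoidAlgebra ℂ Γ,
      x - MonoidAlgebra.single 1 (MonoidAlgebra.lift ℂ ℂ Γ 1 x) ∈ R.augIdeal := by
    intro x
    induction x using MonoidAlgebra.induction_linear with
    | zero => simp
    | add x y hx hy =>
      rw [map_add, MonoidAlgebra.single_add, add_sub_add_comm]
      exact add_mem hx hy
    | single γ c =>
      have := R.augIdeal.smul_mem (MonoidAlgebra.single 1 c) (R.single_sub_one_mem_augIdeal γ)
      simpa [mul_sub, MonoidAlgebra.single_mul_single] using this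
  simpa [hx] using h x

/-- The complexified resolution as a complex of representations. -/
def complexC : ChainComplex (Rep ℂ Γ) ℕ :=
  ChainComplex.of (fun k => Rep.of (freeRepresentation Γ (R.rank k)))
    (fun k => Rep.ofHom (freeMap (R.mat k))) fun k => by
      apply Rep.hom_ext
      change (freeMap (R.mat k)).comp (freeMap (R.mat (k + 1))) = 0
      refine DFunLike.ext _ _ fun x => ?_
      change freeMap (R.mat k) (freeMap (R.mat (k + 1)) x) = 0
      rw [freeMap_apply, freeMap_apply, Matrix.vecMul_vecMul, mat_mul_mat, Matrix.vecMul_zero]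

theorem complexC_d (k : ℕ) :
    R.complexC.d (k + 1) k = Rep.ofHom (freeMap (R.mat k)) :=
  ChainComplex.of_d (fun k => Rep.of (freeRepresentation Γ (R.rank k)))
    (fun k => Rep.ofHom (freeMap (R.mat k))) k

/-- The augmentation of the complexified resolution. -/
def augC : Rep.of (freeRepresentation Γ (R.rank 0)) ⟶ Rep.trivial ℂ Γ ℂ :=
  Rep.ofHom (freeLift (Representation.trivial ℂ Γ ℂ) fun _ => 1)

theorem augC_apply (x : Fin (R.rank 0) → MonoidAlgebra ℂ Γ) :
    R.augC.hom x = MonoidAlgebra.lift ℂ ℂ Γ 1 (x R.idx) := by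
  have : ∀ a : MonoidAlgebra ℂ Γ, (Representation.trivial ℂ Γ ℂ).asAlgebraHom a 1 =
      MonoidAlgebra.lift ℂ ℂ Γ 1 a := by
    intro a
    induction a using MonoidAlgebra.induction_linear with
    | zero => simp
    | add a b ha hb => simp [ha, hb]
    | single γ c => simp [Representation.asAlgebraHom_single]
  change freeLift _ _ x = _
  rw [freeLift_apply, Fintype.sum_unique]
  exact this _

theorem augC_freeMap (x : Fin (R.rank 1) → MonoidAlgebra ℂ Γ) :
    R.augC.hom (freeMap (R.mat 0) x) = 0 := by
  rw [augC_apply, freeMap_apply]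
  simp only [Matrix.vecMul, dotProduct, map_sum, map_mul]
  exact Finset.sum_eq_zero fun i _ => by rw [← gen, sum_coeff_gen, mul_zero]

theorem exists_freeMap_eq_of_augC (x : Fin (R.rank 0) → MonoidAlgebra ℂ Γ)
    (hx : R.augC.hom x = 0) : ∃ y, freeMap (R.mat 0) y = x := by
  rw [augC_apply] at hx
  obtain ⟨y, hy⟩ := (R.mem_augIdeal_iff _).1 (R.mem_augIdeal_of_augmentation _ hx)
  refine ⟨y, ?_⟩
  rw [freeMap_apply]
  refine funext fun i => ?_
  obtain rfl : i = R.idx := Subsingleton.elim _ _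
  exact hy

theorem exists_freeMap_eq_of_freeMap (k : ℕ) (x : Fin (R.rank (k + 1)) → MonoidAlgebra ℂ Γ)
    (hx : freeMap (R.mat k) x = 0) : ∃ y, freeMap (R.mat (k + 1)) y = x := by
  rw [freeMap_apply] at hx
  obtain ⟨y, hy⟩ := R.exists_eq_vecMul_mat k x hx
  exact ⟨y, by rw [freeMap_apply, hy]⟩

theorem complexC_d_comp_augC : R.complexC.d 1 0 ≫ R.augC = 0 := by
  rw [complexC_d]
  apply Rep.hom_ext
  exact DFunLike.ext _ _ fun x => R.augC_freeMap x

theorem complexC_d_hom (k : ℕ) (x : Fin (R.rank (k + 1)) → MonoidAlgebra ℂ Γ) :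
    (R.complexC.d (k + 1) k).hom x = freeMap (R.mat k) x :=
  congrArg (fun φ : Rep.of (freeRepresentation Γ (R.rank (k + 1))) ⟶
    Rep.of (freeRepresentation Γ (R.rank k)) => φ.hom x) (R.complexC_d k)

/-- The augmentation as a morphism of complexes. -/
def augComplexC : R.complexC ⟶ (ChainComplex.single₀ (Rep ℂ Γ)).obj (Rep.trivial ℂ Γ ℂ) :=
  (R.complexC.toSingle₀Equiv _).symm ⟨R.augC, R.complexC_d_comp_augC⟩

theorem augComplexC_f_zero : R.augComplexC.f 0 = R.augC :=
  ChainComplex.toSingle₀Equiv_symm_apply_f_zero (C := R.complexC) (X := Rep.trivial ℂ Γ ℂ)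
    R.augC R.complexC_d_comp_augC

theorem augComplexC_hom (x : Fin (R.rank 0) → MonoidAlgebra ℂ Γ) :
    (R.augComplexC.f 0).hom x = R.augC.hom x :=
  congrArg (fun φ : Rep.of (freeRepresentation Γ (R.rank 0)) ⟶
    Rep.trivial ℂ Γ ℂ => φ.hom x) R.augComplexC_f_zero

theorem quasiIso_augComplexC : QuasiIso R.augComplexC where
  quasiIsoAt n := by
    cases n with
    | zero =>
      rw [ChainComplex.quasiIsoAt₀_iff, ShortComplex.quasiIso_iff_of_zeros' _ rfl rfl rfl]
      constructor
      · apply (forget₂ _ (ModuleCat ℂ)).reflects_exact_of_faithful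
        rw [ShortComplex.moduleCat_exact_iff]
        intro x hx
        obtain ⟨y, hy⟩ := R.exists_freeMap_eq_of_augC x ((R.augComplexC_hom x).symm.trans hx)
        exact ⟨y, (R.complexC_d_hom 0 y).trans hy⟩
      · rw [Rep.epi_iff_surjective]
        intro c
        refine ⟨fun _ => MonoidAlgebra.single 1 c, (R.augComplexC_hom _).trans ?_⟩
        have h : ∀ z : ℂ, MonoidAlgebra.lift ℂ ℂ Γ 1 (MonoidAlgebra.single 1 z) = z := by simp
        exact (R.augC_apply _).trans (h c)
    | succ m =>
      rw [quasiIsoAt_iff_exactAt' (hL := ChainComplex.exactAt_succ_single_obj ..),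
          HomologicalComplex.exactAt_iff' _ (m + 2) (m + 1) m (by simp) (by simp)]
      apply (forget₂ _ (ModuleCat ℂ)).reflects_exact_of_faithful
      rw [ShortComplex.moduleCat_exact_iff]
      intro x hx
      obtain ⟨y, hy⟩ := R.exists_freeMap_eq_of_freeMap m x ((R.complexC_d_hom m x).symm.trans hx)
      exact ⟨y, (R.complexC_d_hom (m + 1) y).trans hy⟩

/-- The complexified resolution is a projective resolution of the trivial representation. -/
def projectiveResolution : ProjectiveResolution (Rep.trivial ℂ Γ ℂ) where
  complex := R.complexC
  projective k := inferInstanceAs (Projective (Rep.of (freeRepresentation Γ (R.rank k))))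
  π := R.augComplexC
  quasiIso := R.quasiIso_augComplexC

/-- The group cohomology in a positive degree vanishes if and only if the complex obtained from the
based resolution is exact there. -/
theorem subsingleton_groupCohomology_iff {V : Type} [AddCommGroup V] [Module ℂ V]
    (π : Representation ℂ Γ V) (k : ℕ) :
    Subsingleton (groupCohomology (Rep.of π) (k + 1)) ↔
      ∀ v : Fin (R.rank (k + 1)) → V, matAct π (R.mat (k + 1)) v = 0 →
        ∃ w, v = matAct π (R.mat k) w := by
  have h₁ : Subsingleton (groupCohomology (Rep.of π) (k + 1)) ↔
      (R.projectiveResolution.complex.linearYonedaObj ℂ (Rep.of π)).ExactAt (k + 1) := by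
    rw [HomologicalComplex.exactAt_iff_isZero_homology,
      ← (groupCohomologyIso (Rep.of π) (k + 1) R.projectiveResolution).isZero_iff,
      ModuleCat.isZero_iff_subsingleton]
  change _ ↔ (R.complexC.linearYonedaObj ℂ (Rep.of π)).ExactAt (k + 1) at h₁
  rw [h₁, HomologicalComplex.exactAt_iff' _ k (k + 1) (k + 2) (by simp) (by simp),
    ShortComplex.moduleCat_exact_iff]
  constructor
  · intro h v hv
    obtain ⟨g, hg⟩ := h (Rep.ofHom (freeLift π v)) (by
      change R.complexC.d (k + 2) (k + 1) ≫ Rep.ofHom (freeLift π v) = 0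
      rw [complexC_d]
      apply Rep.hom_ext
      change (freeLift π v).comp (freeMap (R.mat (k + 1))) = 0
      rw [freeLift_comp_freeMap, hv, freeLift_zero])
    let g' : Rep.of (freeRepresentation Γ (R.rank k)) ⟶ Rep.of π := g
    have hg' : R.complexC.d (k + 1) k ≫ g' = Rep.ofHom (freeLift π v) := hg
    rw [complexC_d] at hg'
    have hg'' : g'.hom.comp (freeMap (R.mat k)) = freeLift π v := congrArg Rep.Hom.hom hg'
    rw [eq_freeLift g'.hom, freeLift_comp_freeMap] at hg''
    exact ⟨_, (freeLift_injective π hg'').symm⟩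
  · intro h f hf
    let f' : Rep.of (freeRepresentation Γ (R.rank (k + 1))) ⟶ Rep.of π := f
    have hf' : R.complexC.d (k + 2) (k + 1) ≫ f' = 0 := hf
    rw [complexC_d] at hf'
    have hf'' : f'.hom.comp (freeMap (R.mat (k + 1))) = 0 := congrArg Rep.Hom.hom hf'
    rw [eq_freeLift f'.hom, freeLift_comp_freeMap, ← freeLift_zero π] at hf''
    obtain ⟨w, hw⟩ := h _ (freeLift_injective π hf'')
    refine ⟨Rep.ofHom (freeLift π w), ?_⟩
    change R.complexC.d (k + 1) k ≫ Rep.ofHom (freeLift π w) = f'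
    rw [complexC_d]
    apply Rep.hom_ext
    change (freeLift π w).comp (freeMap (R.mat k)) = f'.hom
    rw [freeLift_comp_freeMap, ← hw, ← eq_freeLift]

end BasedResolution

end

end HigherT

/-! ### Unitary representations -/

namespace HigherT

noncomputable section

section Unitary

variable {Γ : Type} [Group Γ] {V : Type} [NormedAddCommGroup V] [InnerProductSpace ℂ V]
  {π : Representation ℂ Γ V} {p q : ℕ}

theorem inner_unitary (hπ : ∀ γ v, ‖π γ v‖ = ‖v‖) (γ : Γ) (v w : V) :
    inner ℂ (π γ v) (π γ w) = inner ℂ v w :=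
  LinearIsometry.inner_map_map (⟨π γ, hπ γ⟩ : V →ₗᵢ[ℂ] V) v w

theorem inner_asAlgebraHom (hπ : ∀ γ v, ‖π γ v‖ = ‖v‖) (a : MonoidAlgebra ℂ Γ) (v w : V) :
    inner ℂ (π.asAlgebraHom a v) w = inner ℂ v (π.asAlgebraHom (star a) w) := by
  induction a using MonoidAlgebra.induction_linear with
  | zero => simp
  | add a b ha hb => simp [ha, hb]
  | single γ c =>
    rw [star_single, Representation.asAlgebraHom_single, Representation.asAlgebraHom_single,
      LinearMap.smul_apply, LinearMap.smul_apply, inner_smul_left, inner_smul_right,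
      ← inner_unitary hπ γ v, ← Module.End.mul_apply, ← map_mul, mul_inv_cancel, map_one,
      Module.End.one_apply]

theorem sum_inner_matAct (hπ : ∀ γ v, ‖π γ v‖ = ‖v‖)
    (M : Matrix (Fin p) (Fin q) (MonoidAlgebra ℂ Γ)) (v : Fin q → V) (w : Fin p → V) :
    ∑ i, inner ℂ (matAct π M v i) (w i) = ∑ j, inner ℂ (v j) (matAct π Mᴴ w j) := by
  simp only [matAct_apply, sum_inner, inner_sum, inner_asAlgebraHom hπ, Matrix.conjTranspose_apply]
  exact Finset.sum_comm

theorem sum_inner_matAct_right (hπ : ∀ γ v, ‖π γ v‖ = ‖v‖)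
    (M : Matrix (Fin p) (Fin q) (MonoidAlgebra ℂ Γ)) (v : Fin p → V) (w : Fin q → V) :
    ∑ i, inner ℂ (v i) (matAct π M w i) = ∑ j, inner ℂ (matAct π Mᴴ v j) (w j) := by
  rw [sum_inner_matAct hπ, Matrix.conjTranspose_conjTranspose]

theorem sum_inner_self (v : Fin p → V) :
    ∑ i, inner ℂ (v i) (v i) = ((∑ i, ‖v i‖ ^ 2 : ℝ) : ℂ) := by
  push_cast
  exact Finset.sum_congr rfl fun i _ => inner_self_eq_norm_sq_to_K _

theorem eq_zero_of_sum_inner_self {v : Fin p → V} (h : ∑ i, inner ℂ (v i) (v i) = 0) : v = 0 := by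
  rw [sum_inner_self, Complex.ofReal_eq_zero,
    Finset.sum_eq_zero_iff_of_nonneg fun i _ => by positivity] at h
  ext1 i
  simpa using h i (Finset.mem_univ i)

/-- The action of `Mᴴ * M` has the same kernel as the action of `M`. -/
theorem matAct_eq_zero_of_conjTranspose_mul (hπ : ∀ γ v, ‖π γ v‖ = ‖v‖)
    (M : Matrix (Fin p) (Fin q) (MonoidAlgebra ℂ Γ)) (v : Fin q → V)
    (h : matAct π Mᴴ (matAct π M v) = 0) : matAct π M v = 0 := by
  apply eq_zero_of_sum_inner_self
  rw [sum_inner_matAct hπ, h]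
  simp

theorem continuous_asAlgebraHom (hπ : ∀ γ v, ‖π γ v‖ = ‖v‖) (a : MonoidAlgebra ℂ Γ) :
    Continuous (π.asAlgebraHom a) := by
  induction a using MonoidAlgebra.induction_linear with
  | zero =>
    rw [map_zero]
    exact continuous_const
  | add a b ha hb =>
    rw [map_add]
    exact ha.add hb
  | single γ c =>
    have : Continuous (π γ) := (⟨π γ, hπ γ⟩ : V →ₗᵢ[ℂ] V).continuous
    rw [Representation.asAlgebraHom_single]
    exact this.const_smul c

theorem continuous_matAct (hπ : ∀ γ v, ‖π γ v‖ = ‖v‖)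
    (M : Matrix (Fin p) (Fin q) (MonoidAlgebra ℂ Γ)) : Continuous (matAct π M) := by
  refine continuous_pi fun i => ?_
  simp only [matAct_apply]
  exact continuous_finsetSum _ fun j _ =>
    (continuous_asAlgebraHom hπ _).comp (continuous_apply j)

theorem matAct_sub (M N : Matrix (Fin p) (Fin q) (MonoidAlgebra ℂ Γ)) (v : Fin q → V) :
    matAct π (M - N) v = matAct π M v - matAct π N v := by
  ext1 i
  simp [matAct_apply]

theorem matAct_smul_one (c : ℂ) (v : Fin p → V) :
    matAct π (c • (1 : Matrix (Fin p) (Fin p) (MonoidAlgebra ℂ Γ))) v = c • v := by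
  ext1 i
  rw [matAct_apply, Finset.sum_eq_single i]
  · simp
  · intro j _ hj
    simp [Matrix.one_apply_ne hj.symm]
  · simp

theorem matAct_scalar (a : MonoidAlgebra ℂ Γ) (v : Fin p → V) (i : Fin p) :
    matAct π (Matrix.scalar (Fin p) a) v i = π.asAlgebraHom a (v i) := by
  rw [matAct_apply, Finset.sum_eq_single i]
  · simp
  · intro j _ hj
    simp [Matrix.diagonal_apply_ne _ hj.symm]
  · simp

theorem matAct_sum {ι : Type} (s : Finset ι) (M : ι → Matrix (Fin p) (Fin q) (MonoidAlgebra ℂ Γ))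
    (v : Fin q → V) : matAct π (∑ t ∈ s, M t) v = ∑ t ∈ s, matAct π (M t) v := by
  ext1 i
  simp only [matAct_apply, Matrix.sum_apply, map_sum, LinearMap.sum_apply, Finset.sum_apply]
  exact Finset.sum_comm

end Unitary

section Vanishing

variable {Γ : Type} [Group Γ] (R : BasedResolution Γ) {V : Type} [NormedAddCommGroup V]
  [InnerProductSpace ℂ V] {π : Representation ℂ Γ V}

/-- Vectors killed by the augmentation ideal are invariant. -/
theorem invariant_of_matAct_zero (v : Fin (R.rank 0) → V) (h : matAct π (R.mat 0) v = 0) (γ : Γ) :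
    π γ (v R.idx) = v R.idx := by
  obtain ⟨y, hy⟩ := (R.mem_augIdeal_iff _).1 (R.single_sub_one_mem_augIdeal γ)
  have hg : ∀ i, π.asAlgebraHom (R.gen i) (v R.idx) = 0 := fun i => by
    have := congrFun h i
    rwa [matAct_apply, Fintype.sum_unique] at this
  have := congrArg (fun a => π.asAlgebraHom a (v R.idx)) hy
  simp only [map_sum, map_mul, map_sub, map_one, LinearMap.sum_apply, Module.End.mul_apply, hg,
    map_zero, Finset.sum_const_zero, LinearMap.sub_apply, Module.End.one_apply,
    Representation.asAlgebraHom_single, one_smul] at this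
  exact (sub_eq_zero.1 this.symm)

theorem eq_zero_of_laplacianZero (hπ : ∀ γ v, ‖π γ v‖ = ‖v‖)
    (hinv : ∀ v, (∀ γ, π γ v = v) → v = 0) (v : V)
    (h : π.asAlgebraHom R.laplacianZero v = 0) : v = 0 := by
  refine hinv v (invariant_of_matAct_zero R (fun _ => v) ?_)
  apply matAct_eq_zero_of_conjTranspose_mul hπ
  rw [← matAct_mul, ← R.laplacian_zero]
  ext1 i
  obtain rfl : i = R.idx := Subsingleton.elim _ _
  rw [matAct_apply, Fintype.sum_unique]
  exact h

/-- If the Laplace operator in degree `k + 1` is onto, every cocycle is a coboundary, by the Hodge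
decomposition. -/
theorem exists_eq_matAct_of_surjective (hπ : ∀ γ v, ‖π γ v‖ = ‖v‖) (k : ℕ)
    (h : Function.Surjective (matAct π (R.laplacian (k + 1)))) (v : Fin (R.rank (k + 1)) → V)
    (hv : matAct π (R.mat (k + 1)) v = 0) : ∃ w, v = matAct π (R.mat k) w := by
  obtain ⟨u, rfl⟩ := h v
  have hd : matAct π (R.mat (k + 1)) (matAct π (R.mat k) (matAct π (R.mat k)ᴴ u)) = 0 := by
    rw [← matAct_mul, R.mat_mul_mat]
    ext1 i
    simp [matAct_apply]
  rw [R.laplacian_succ, matAct_add, matAct_mul, matAct_mul] at hv ⊢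
  rw [map_add, hd, zero_add] at hv
  -- The part `d^* d u` of the decomposition is a cocycle, hence zero.
  have h₁ : matAct π (R.mat (k + 1))ᴴ (matAct π (R.mat (k + 1)) u) = 0 := by
    apply matAct_eq_zero_of_conjTranspose_mul hπ
    rwa [Matrix.conjTranspose_conjTranspose]
  exact ⟨matAct π (R.mat k)ᴴ u, by rw [h₁, add_zero]⟩

variable [CompleteSpace V]

theorem denseRange_laplacianZero (hπ : ∀ γ v, ‖π γ v‖ = ‖v‖)
    (hinv : ∀ v, (∀ γ, π γ v = v) → v = 0) :
    DenseRange (π.asAlgebraHom R.laplacianZero) := by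
  have h : (LinearMap.range (π.asAlgebraHom R.laplacianZero))ᗮ = ⊥ := by
    rw [Submodule.eq_bot_iff]
    intro w hw
    apply eq_zero_of_laplacianZero R hπ hinv
    rw [← inner_self_eq_zero (𝕜 := ℂ)]
    have := (Submodule.mem_orthogonal _ _).1 hw
      (π.asAlgebraHom R.laplacianZero (π.asAlgebraHom R.laplacianZero w)) ⟨_, rfl⟩
    rwa [inner_asAlgebraHom hπ, R.star_laplacianZero] at this
  rw [← Submodule.topologicalClosure_eq_top_iff, ← Submodule.dense_iff_topologicalClosure_eq_top]
    at h
  exact h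

/-- A coercive matrix over `ℂΓ` acts surjectively. -/
theorem surjective_matAct_of_coercive (hπ : ∀ γ v, ‖π γ v‖ = ‖v‖) {m : ℕ}
    (M : Matrix (Fin m) (Fin m) (MonoidAlgebra ℂ Γ)) {ε : ℝ} (hε : 0 < ε)
    (h : ∀ v : Fin m → V, ε * ∑ i, ‖v i‖ ^ 2 ≤ (∑ i, inner ℂ (v i) (matAct π M v i)).re) :
    Function.Surjective (matAct π M) := by
  let e := PiLp.continuousLinearEquiv 2 ℂ fun _ : Fin m => V
  let T : PiLp 2 (fun _ : Fin m => V) →L[ℂ] PiLp 2 (fun _ : Fin m => V) :=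
    e.symm.toContinuousLinearMap ∘L
      (⟨matAct π M, continuous_matAct hπ M⟩ : (Fin m → V) →L[ℂ] (Fin m → V)) ∘L
        e.toContinuousLinearMap
  have hT : ∀ x i, T x i = matAct π M (e x) i := fun x i => rfl
  have hu : IsUnit T := by
    refine ContinuousLinearMap.isUnit_of_forall_le_norm_inner_map T (c := ⟨ε, hε.le⟩) hε ?_
    intro x
    have h₁ := h (e x)
    have h₂ : (∑ i, inner ℂ (e x i) (matAct π M (e x) i)) = inner ℂ x (T x) := by
      rw [PiLp.inner_apply]
      rfl
    have h₃ : ∑ i, ‖e x i‖ ^ 2 = ‖x‖ ^ 2 := by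
      rw [PiLp.norm_sq_eq_of_L2]
      rfl
    rw [h₂, h₃] at h₁
    rw [norm_inner_symm, mul_comm]
    exact h₁.trans (Complex.re_le_norm _)
  intro v
  obtain ⟨x, hx⟩ := ((ContinuousLinearMap.isUnit_iff_bijective).1 hu).2 (e.symm v)
  refine ⟨e x, ?_⟩
  ext1 i
  rw [← hT, hx]
  rfl

/-- Positivity of `Δ₀ (Δ - ε) Δ₀` makes `Δ` coercive, as the range of `Δ₀` is dense. -/
theorem coercive_of_sum_of_squares (hπ : ∀ γ v, ‖π γ v‖ = ‖v‖)
    (hinv : ∀ v, (∀ γ, π γ v = v) → v = 0) {m : ℕ}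
    (M : Matrix (Fin m) (Fin m) (MonoidAlgebra ℂ Γ)) (ε : ℝ) (j : ℕ)
    (x : Fin j → Matrix (Fin m) (Fin m) (MonoidAlgebra ℂ Γ))
    (hx : Matrix.scalar (Fin m) R.laplacianZero * (M - (ε : ℂ) • 1) *
      Matrix.scalar (Fin m) R.laplacianZero = ∑ t, (x t)ᴴ * x t) (v : Fin m → V) :
    ε * ∑ i, ‖v i‖ ^ 2 ≤ (∑ i, inner ℂ (v i) (matAct π M v i)).re := by
  have hdense : DenseRange fun (w : Fin m → V) i => π.asAlgebraHom R.laplacianZero (w i) :=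
    DenseRange.piMap fun _ => denseRange_laplacianZero R hπ hinv
  have hclosed : IsClosed {v : Fin m → V |
      ε * ∑ i, ‖v i‖ ^ 2 ≤ (∑ i, inner ℂ (v i) (matAct π M v i)).re} := by
    have := continuous_matAct hπ M
    refine isClosed_le (by fun_prop) ?_
    refine Complex.continuous_re.comp (continuous_finsetSum _ fun i _ => ?_)
    exact (continuous_apply i).inner ((continuous_apply i).comp this)
  refine hdense.induction_on (p := fun v : Fin m → V =>
    ε * ∑ i, ‖v i‖ ^ 2 ≤ (∑ i, inner ℂ (v i) (matAct π M v i)).re) v hclosed fun w => ?_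
  set u := fun i => π.asAlgebraHom R.laplacianZero (w i) with hu
  have hu' : u = matAct π (Matrix.scalar (Fin m) R.laplacianZero) w := by
    ext1 i
    rw [matAct_scalar]
  have hs : (Matrix.scalar (Fin m) R.laplacianZero)ᴴ = Matrix.scalar (Fin m) R.laplacianZero := by
    simp [Matrix.scalar_apply, Matrix.diagonal_conjTranspose, Pi.star_def, R.star_laplacianZero]
  have key : ∑ i, inner ℂ (u i) (matAct π (M - (ε : ℂ) • 1) u i) =
      ((∑ t, ∑ i, ‖matAct π (x t) w i‖ ^ 2 : ℝ) : ℂ) := by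
    have h₁ : ∑ i, inner ℂ (u i) (matAct π (M - (ε : ℂ) • 1) u i) =
        ∑ i, inner ℂ (w i) (matAct π (∑ t, (x t)ᴴ * x t) w i) := by
      rw [← hx, matAct_mul, matAct_mul, ← hu', sum_inner_matAct_right hπ
        (Matrix.scalar (Fin m) R.laplacianZero), hs, ← hu']
    rw [h₁, matAct_sum]
    simp only [Finset.sum_apply, inner_sum]
    rw [Finset.sum_comm, Complex.ofReal_sum]
    refine Finset.sum_congr rfl fun t _ => ?_
    simp only [matAct_mul]
    rw [← sum_inner_matAct hπ, sum_inner_self]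
  have h₂ : ∑ i, inner ℂ (u i) (matAct π (M - (ε : ℂ) • 1) u i) =
      ∑ i, inner ℂ (u i) (matAct π M u i) - ((ε * ∑ i, ‖u i‖ ^ 2 : ℝ) : ℂ) := by
    rw [matAct_sub, matAct_smul_one, Complex.ofReal_mul, ← sum_inner_self]
    simp [Finset.sum_sub_distrib, Finset.mul_sum]
  have h₃ := congrArg Complex.re (h₂.symm.trans key)
  rw [Complex.sub_re, Complex.ofReal_re, Complex.ofReal_re] at h₃
  have h₄ : 0 ≤ ∑ t, ∑ i, ‖matAct π (x t) w i‖ ^ 2 := by positivity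
  linarith

theorem propertyT_of_sum_of_squares {n : ℕ} {Γ : Type} [Group Γ] (R : BasedResolution Γ)
    (h : ∀ k ≤ n, ∃ ε : ℝ, 0 < ε ∧
      ∃ (j : ℕ) (x : Fin j → Matrix (Fin (R.rank k)) (Fin (R.rank k)) (MonoidAlgebra ℂ Γ)),
        Matrix.scalar (Fin (R.rank k)) R.laplacianZero * (R.laplacian k - (ε : ℂ) • 1) *
          Matrix.scalar (Fin (R.rank k)) R.laplacianZero = ∑ i, (x i)ᴴ * x i) :
    PropertyT n Γ := by
  intro V _ _ _ π hπ hinv j hj hjn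
  obtain ⟨k, rfl⟩ := Nat.exists_eq_add_of_le' hj
  obtain ⟨ε, hε, t, x, hx⟩ := h (k + 1) hjn
  rw [R.subsingleton_groupCohomology_iff]
  exact exists_eq_matAct_of_surjective R hπ k (surjective_matAct_of_coercive hπ _ hε
    (coercive_of_sum_of_squares R hπ hinv _ ε t x hx))

end Vanishing

end

end HigherT

/-! ### Property `(T_1)` and additive characters -/

namespace HigherT

noncomputable section

section Characters

open scoped ENNReal

variable {Γ : Type}

/-- The unitary character `γ ↦ exp(i b(γ) / (n + 1))` attached to an additive character `b`. -/
def expCharacter (b : Γ → ℝ) (n : ℕ) (γ : Γ) : ℂ := Complex.exp (Complex.I * (b γ / (n + 1) : ℝ))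

theorem norm_expCharacter (b : Γ → ℝ) (n : ℕ) (γ : Γ) : ‖expCharacter b n γ‖ = 1 := by
  rw [expCharacter, mul_comm, Complex.norm_exp_ofReal_mul_I]

theorem norm_expCharacter_sub_one_le (b : Γ → ℝ) (n : ℕ) (γ : Γ) :
    ‖expCharacter b n γ - 1‖ ≤ |b γ| * (1 / (n + 1)) := by
  refine (Real.norm_exp_I_mul_ofReal_sub_one_le).trans_eq ?_
  rw [Real.norm_eq_abs, abs_div, abs_of_pos (by positivity : (0 : ℝ) < n + 1), div_eq_mul_one_div]

theorem expCharacter_ne_one {b : Γ → ℝ} {γ : Γ} (h : b γ = 1) (n : ℕ) :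
    expCharacter b n γ ≠ 1 := by
  rw [expCharacter, h, Ne, Complex.exp_eq_one_iff]
  rintro ⟨k, hk⟩
  have h₁ : (1 / (n + 1) : ℝ) = k * (2 * Real.pi) := by
    have : Complex.I * ((1 / (n + 1) : ℝ) : ℂ) = Complex.I * ((k * (2 * Real.pi) : ℝ) : ℂ) := by
      rw [hk]; push_cast; ring
    exact_mod_cast mul_left_cancel₀ Complex.I_ne_zero this
  have h₂ : (0 : ℝ) < 1 / (n + 1) := by positivity
  have h₃ : (1 / (n + 1) : ℝ) ≤ 1 := by
    rw [div_le_one (by positivity)]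
    linarith [(Nat.cast_nonneg n : (0 : ℝ) ≤ n)]
  have hπ := Real.pi_gt_three
  have hk₀ : 0 < k := by
    by_contra hk₀
    have : (k : ℝ) ≤ 0 := by exact_mod_cast not_lt.1 hk₀
    nlinarith
  have : (1 : ℝ) ≤ k := by exact_mod_cast hk₀
  nlinarith

variable [Group Γ]

theorem expCharacter_mul {b : Γ → ℝ} (hb : ∀ γ δ, b (γ * δ) = b γ + b δ) (n : ℕ) (γ δ : Γ) :
    expCharacter b n (γ * δ) = expCharacter b n γ * expCharacter b n δ := by
  rw [expCharacter, expCharacter, expCharacter, ← Complex.exp_add, hb, add_div, Complex.ofReal_add,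
    mul_add]

/-- The Hilbert sum of the unitary characters `expCharacter b n`, a representation on `ℓ²`. -/
def expRepresentation {b : Γ → ℝ} (hb : ∀ γ δ, b (γ * δ) = b γ + b δ) :
    Representation ℂ Γ (lp (fun _ : ℕ => ℂ) 2) where
  toFun γ :=
    { toFun := fun v => ⟨fun n => expCharacter b n γ * v n, by
        refine (lp.memℓp v).mono' (g := v) fun n => ?_
        simp [norm_expCharacter]⟩
      map_add' := fun v w => by
        ext n
        exact mul_add _ _ _
      map_smul' := fun c v => by
        ext n
        exact mul_left_comm _ _ _ }
  map_one' := by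
    refine LinearMap.ext fun v => ?_
    ext n
    have h₁ : b 1 = 0 := by simpa using hb 1 1
    change expCharacter b n 1 * v n = v n
    simp [expCharacter, h₁]
  map_mul' γ δ := by
    refine LinearMap.ext fun v => ?_
    ext n
    change expCharacter b n (γ * δ) * v n = expCharacter b n γ * (expCharacter b n δ * v n)
    rw [expCharacter_mul hb, mul_assoc]

theorem expRepresentation_apply {b : Γ → ℝ} (hb : ∀ γ δ, b (γ * δ) = b γ + b δ) (γ : Γ)
    (v : lp (fun _ : ℕ => ℂ) 2) (n : ℕ) :
    expRepresentation hb γ v n = expCharacter b n γ * v n := rfl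

theorem norm_expRepresentation {b : Γ → ℝ} (hb : ∀ γ δ, b (γ * δ) = b γ + b δ) (γ : Γ)
    (v : lp (fun _ : ℕ => ℂ) 2) : ‖expRepresentation hb γ v‖ = ‖v‖ := by
  simp [lp.norm_eq_tsum_rpow (p := 2) (by norm_num), expRepresentation_apply, norm_expCharacter]

/-- The cocycle `γ ↦ (χ_n(γ) - 1)_n` with values in the Hilbert sum of the characters `χ_n`. It is
the formal coboundary of the constant sequence `1`, which is not square summable. -/
def expCocycle (b : Γ → ℝ) (γ : Γ) : lp (fun _ : ℕ => ℂ) 2 :=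
  ⟨fun n => expCharacter b n γ - 1, by
    refine Memℓp.mono (g := fun n : ℕ => |b γ| * (1 / ((n : ℝ) + 1))) ?_
      fun n => norm_expCharacter_sub_one_le b n γ
    refine memℓp_gen ?_
    have h : Summable fun n : ℕ => 1 / ((n : ℝ) + 1) ^ 2 := by
      have := (summable_nat_add_iff 1).2 (Real.summable_one_div_nat_pow.2 (by norm_num : 1 < 2))
      simpa using this
    refine (h.mul_left (|b γ| ^ 2)).congr fun n => ?_
    simp [mul_pow, sq_abs]⟩

theorem additive_character_eq_zero {n : ℕ} (hn : 1 ≤ n) (hT : PropertyT n Γ) {b : Γ → ℝ}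
    (hb : ∀ γ δ, b (γ * δ) = b γ + b δ) (γ : Γ) : b γ = 0 := by
  by_contra hγ
  -- Rescale so that the character takes the value `1`.
  let b' : Γ → ℝ := fun δ => b δ / b γ
  have hb' : ∀ δ δ', b' (δ * δ') = b' δ + b' δ' := fun δ δ' => by simp [b', hb, add_div]
  have hb'γ : b' γ = 1 := div_self hγ
  have hinj : ∀ m z, (expCharacter b' m γ - 1) * z = 0 → z = 0 := fun m z hz =>
    (mul_eq_zero.1 hz).resolve_left (sub_ne_zero.2 (expCharacter_ne_one hb'γ m))
  have hsub := hT _ (expRepresentation hb') (norm_expRepresentation hb') (fun v hv => by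
    ext m
    refine hinj m _ ?_
    rw [sub_mul, one_mul, ← expRepresentation_apply hb', hv, sub_self]) 1 le_rfl hn
  let c : groupCohomology.cocycles₁ (Rep.of (expRepresentation hb')) :=
    ⟨expCocycle b', (groupCohomology.mem_cocycles₁_iff _).2 fun δ δ' => by
      ext m
      change expCharacter b' m (δ * δ') - 1 =
        expCharacter b' m δ * (expCharacter b' m δ' - 1) + (expCharacter b' m δ - 1)
      rw [expCharacter_mul hb']
      ring⟩
  have hc := (groupCohomology.H1π_eq_zero_iff c).1 (Subsingleton.elim _ _)
  obtain ⟨v, hv⟩ := hc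
  have hv' : ∀ m, (v : lp (fun _ : ℕ => ℂ) 2) m = 1 := fun m => by
    have : expCharacter b' m γ * (v : lp (fun _ : ℕ => ℂ) 2) m -
        (v : lp (fun _ : ℕ => ℂ) 2) m = expCharacter b' m γ - 1 :=
      congrArg (fun w : lp (fun _ : ℕ => ℂ) 2 => w m) (congrFun hv γ)
    refine sub_eq_zero.1 (hinj m _ ?_)
    linear_combination this
  have hs := (lp.memℓp (v : lp (fun _ : ℕ => ℂ) 2)).summable (by norm_num)
  simp only [hv', norm_one, Real.one_rpow] at hs
  exact one_ne_zero (tendsto_nhds_unique tendsto_const_nhds hs.tendsto_atTop_zero)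

/-- Under property `(T_n)` there are no nonzero homomorphisms to `ℂ`. -/
theorem complex_character_eq_zero {n : ℕ} (hn : 1 ≤ n) (hT : PropertyT n Γ) {b : Γ → ℂ}
    (hb : ∀ γ δ, b (γ * δ) = b γ + b δ) (γ : Γ) : b γ = 0 :=
  Complex.ext (additive_character_eq_zero hn hT (b := fun γ => (b γ).re) (by simp [hb]) γ)
    (additive_character_eq_zero hn hT (b := fun γ => (b γ).im) (by simp [hb]) γ)

end Characters

end

end HigherT

/-! ### Cones with an order unit -/

namespace HigherT

noncomputable section

section OrderUnit

variable {W : Type} [AddCommGroup W] [Module ℝ W]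

theorem cone_smul_mem (C : PointedCone ℝ W) {t : ℝ} (ht : 0 ≤ t) {c : W} (hc : c ∈ C) :
    t • c ∈ C :=
  C.smul_mem ht hc

/-- An element which dominates the cone dominates its linear span, on both sides. -/
theorem exists_dominating_of_mem_span (C : PointedCone ℝ W) {e : W} (he : e ∈ C)
    (hunit : ∀ c ∈ C, ∃ r : ℝ, r • e - c ∈ C) {v : W} (hv : v ∈ Submodule.span ℝ (C : Set W)) :
    ∃ r : ℝ, r • e - v ∈ C ∧ r • e + v ∈ C := by
  induction hv using Submodule.span_induction with
  | mem c hc =>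
    obtain ⟨r, hr⟩ := hunit c hc
    refine ⟨|r|, ?_, C.add_mem (cone_smul_mem C (abs_nonneg r) he) hc⟩
    have := C.add_mem (cone_smul_mem C (sub_nonneg.2 (le_abs_self r)) he) hr
    convert this using 1
    module
  | zero => exact ⟨0, by simp, by simp⟩
  | add v w _ _ hv hw =>
    obtain ⟨r, h₁, h₂⟩ := hv
    obtain ⟨s, h₃, h₄⟩ := hw
    refine ⟨r + s, ?_, ?_⟩
    · convert C.add_mem h₁ h₃ using 1; module
    · convert C.add_mem h₂ h₄ using 1; module
  | smul t v _ hv =>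
    obtain ⟨r, h₁, h₂⟩ := hv
    rcases le_total 0 t with ht | ht
    · refine ⟨t * r, ?_, ?_⟩
      · convert cone_smul_mem C ht h₁ using 1; module
      · convert cone_smul_mem C ht h₂ using 1; module
    · refine ⟨-t * r, ?_, ?_⟩
      · convert cone_smul_mem C (neg_nonneg.2 ht) h₂ using 1; module
      · convert cone_smul_mem C (neg_nonneg.2 ht) h₁ using 1; module

/-- The Hahn-Banach separation theorem for a cone with an order unit `e`: an element on which all
states are positive lies above a positive multiple of `e`. -/
theorem exists_sub_smul_mem_of_forall_state (C : PointedCone ℝ W) {e a : W} (he : e ∈ C)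
    (hunit : ∀ c ∈ C, ∃ r : ℝ, r • e - c ∈ C) (ha : a ∈ Submodule.span ℝ (C : Set W))
    (hpos : ∀ g : W →ₗ[ℝ] ℝ, (∀ c ∈ C, 0 ≤ g c) → g e = 1 → 0 < g a) :
    ∃ ε : ℝ, 0 < ε ∧ a - ε • e ∈ C := by
  by_contra hcon
  have hcon' : ∀ ε : ℝ, 0 < ε → a - ε • e ∉ C := fun ε hε h => hcon ⟨ε, hε, h⟩
  obtain ⟨r₀, h₀, h₀'⟩ := exists_dominating_of_mem_span C he hunit ha
  have hne : -e ∉ C := fun h => hcon' 1 one_pos <| by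
    have := C.add_mem h₀' (cone_smul_mem C (add_nonneg (abs_nonneg r₀) zero_le_one) h)
    have := C.add_mem this (cone_smul_mem C (sub_nonneg.2 (le_abs_self r₀)) he)
    convert this using 1
    module
  let E := Submodule.span ℝ (C : Set W)
  have heE : e ∈ E := Submodule.subset_span he
  let e' : E := ⟨e, heE⟩
  let a' : E := ⟨a, ha⟩
  have he' : e' ≠ 0 := fun h => hne <| by
    have : e = 0 := congrArg Subtype.val h
    simp [this]
  let C₁ : PointedCone ℝ E := C.comap E.subtype
  let C₂ : PointedCone ℝ E := C₁ ⊔ Submodule.span _ {-a'}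
  have hC₁ : ∀ x : E, x ∈ C₁ ↔ (x : W) ∈ C := fun x => Iff.rfl
  let f : E →ₗ.[ℝ] ℝ := LinearPMap.mkSpanSingleton e' (1 : ℝ) he'
  obtain ⟨g, hge, hg⟩ := riesz_extension C₂ f (by
    rintro ⟨x, hx⟩ hxC
    obtain ⟨t, rfl⟩ := Submodule.mem_span_singleton.1 hx
    have hval : f ⟨t • e', hx⟩ = t := by
      dsimp only [f]
      rw [LinearPMap.mkSpanSingleton'_apply]
      simp
    rw [hval]
    by_contra! ht
    obtain ⟨c, hc, y, hy, hcy⟩ := Submodule.mem_sup.1 hxC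
    obtain ⟨s, rfl⟩ := Submodule.mem_span_singleton.1 hy
    have h₁ : (c : W) = t • e + (s : ℝ) • a := by
      have h₂ : (c : W) + (s : ℝ) • (-a) = t • e := congrArg Subtype.val hcy
      rw [← h₂]
      module
    have hcC : (c : W) ∈ C := hc
    rcases eq_or_lt_of_le s.2 with hs | hs
    · have hs' : (s : ℝ) = 0 := hs.symm
      rw [h₁, hs'] at hcC
      apply hne
      have := cone_smul_mem C (inv_nonneg.2 (neg_nonneg.2 ht.le)) hcC
      convert this using 1
      rw [zero_smul, add_zero, smul_smul, inv_neg, neg_mul, inv_mul_cancel₀ ht.ne, neg_one_smul]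
    · have hs' : (0 : ℝ) < s := hs
      apply hcon' (-t / s) (div_pos (neg_pos.2 ht) hs')
      have := cone_smul_mem C (inv_nonneg.2 hs'.le) hcC
      convert this using 1
      rw [h₁, smul_add, smul_smul, smul_smul, inv_mul_cancel₀ hs'.ne', div_eq_inv_mul]
      module) (by
    intro y
    obtain ⟨r, -, hr⟩ := exists_dominating_of_mem_span C he hunit y.2
    refine ⟨⟨r • e', Submodule.mem_span_singleton.2 ⟨r, rfl⟩⟩, ?_⟩
    exact Submodule.mem_sup_left (show _ ∈ C₁ from hr))
  obtain ⟨G, hG⟩ := LinearMap.exists_extend g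
  have hG' : ∀ x : E, G x = g x := fun x => LinearMap.congr_fun hG x
  have h₁ : G e = 1 := by
    have := hge ⟨e', Submodule.mem_span_singleton_self _⟩
    rw [← hG'] at this
    refine this.trans ?_
    exact LinearPMap.mkSpanSingleton_apply ℝ ℝ he' (1 : ℝ)
  have h₂ := hpos G (fun c hc => by
    have hcE : c ∈ E := Submodule.subset_span hc
    have := hg ⟨c, hcE⟩ (Submodule.mem_sup_left (show _ ∈ C₁ from hc))
    rwa [← hG'] at this) h₁
  have h₃ := hg (-a') (Submodule.mem_sup_right (Submodule.mem_span_singleton_self _))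
  rw [map_neg, ← hG'] at h₃
  have : G a = G a' := rfl
  linarith

end OrderUnit

end

end HigherT

/-! ### The cone of sums of squares over the augmentation ideal -/

namespace HigherT

noncomputable section

section Squares

variable {Γ : Type} [Group Γ] {m p : ℕ}

/-- The square `r^* r` of a row vector over `ℂΓ`. -/
abbrev rowSquare (r : Fin m → MonoidAlgebra ℂ Γ) : Matrix (Fin m) (Fin m) (MonoidAlgebra ℂ Γ) :=
  Matrix.vecMulVec (star r) r

theorem conjTranspose_mul_self_eq_sum (M : Matrix (Fin p) (Fin m) (MonoidAlgebra ℂ Γ)) :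
    Mᴴ * M = ∑ i, rowSquare (M i) := by
  ext1 a b
  rw [Matrix.mul_apply, Matrix.sum_apply]
  rfl

theorem rowSquare_eq_conjTranspose_mul (i₀ : Fin m) (r : Fin m → MonoidAlgebra ℂ Γ) :
    rowSquare r = (Matrix.of fun i => if i = i₀ then r else 0)ᴴ *
      Matrix.of fun i => if i = i₀ then r else 0 := by
  rw [conjTranspose_mul_self_eq_sum, Finset.sum_eq_single i₀]
  · change rowSquare r = rowSquare (if i₀ = i₀ then r else 0)
    rw [if_pos rfl]
  · intro i _ hi
    change rowSquare (if i = i₀ then r else 0) = 0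
    rw [if_neg hi, rowSquare, star_zero, Matrix.zero_vecMulVec]
  · simp

theorem rowSquare_single_smul (γ : Γ) (c : ℂ) (r : Fin m → MonoidAlgebra ℂ Γ) :
    rowSquare (MonoidAlgebra.single γ c • r) = (‖c‖ ^ 2 : ℝ) • rowSquare r := by
  ext1 a b
  have h : (MonoidAlgebra.single γ⁻¹ (starRingEnd ℂ c) : MonoidAlgebra ℂ Γ) *
      MonoidAlgebra.single γ c = ((‖c‖ ^ 2 : ℝ) : ℂ) • 1 := by
    rw [MonoidAlgebra.single_mul_single, inv_mul_cancel, mul_comm, Complex.mul_conj,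
      Complex.normSq_eq_norm_sq, MonoidAlgebra.one_def, MonoidAlgebra.smul_single, smul_eq_mul,
      mul_one]
  simp only [Matrix.vecMulVec_apply, Pi.star_apply, Pi.smul_apply, smul_eq_mul, star_mul,
    star_single, Matrix.smul_apply]
  rw [mul_assoc, ← mul_assoc (MonoidAlgebra.single γ⁻¹ _), h, smul_mul_assoc, one_mul,
    mul_smul_comm, Complex.coe_smul]

theorem rowSquare_add_add_rowSquare_sub (r s : Fin m → MonoidAlgebra ℂ Γ) :
    rowSquare (r + s) + rowSquare (r - s) = (2 : ℝ) • rowSquare r + (2 : ℝ) • rowSquare s := by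
  ext1 a b
  simp only [Matrix.vecMulVec_apply, Pi.star_apply, Pi.add_apply, Pi.sub_apply, star_add,
    star_sub, Matrix.add_apply, two_smul]
  noncomm_ring

end Squares

namespace BasedResolution

variable {Γ : Type} [Group Γ] (R : BasedResolution Γ) (m : ℕ)

/-- The `ℂΓ`-module of row vectors with entries in the augmentation ideal. -/
def augRows : Submodule (MonoidAlgebra ℂ Γ) (Fin m → MonoidAlgebra ℂ Γ) :=
  Submodule.pi Set.univ fun _ => R.augIdeal

variable {m} in
theorem mem_augRows {r : Fin m → MonoidAlgebra ℂ Γ} : r ∈ R.augRows m ↔ ∀ i, r i ∈ R.augIdeal := by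
  simp [augRows]

theorem single_mem_augRows {x : MonoidAlgebra ℂ Γ} (hx : x ∈ R.augIdeal) (j : Fin m) :
    Pi.single j x ∈ R.augRows m := by
  rw [mem_augRows]
  intro i
  rcases eq_or_ne i j with rfl | h
  · simpa using hx
  · simp [h]

/-- The cone of sums of squares of row vectors with entries in the augmentation ideal. -/
def squareCone : PointedCone ℝ (Matrix (Fin m) (Fin m) (MonoidAlgebra ℂ Γ)) :=
  PointedCone.hull ℝ (rowSquare '' (R.augRows m : Set (Fin m → MonoidAlgebra ℂ Γ)))

/-- The operator `Δ₀` as a scalar matrix. It is an order unit for the cone of sums of squares over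
the augmentation ideal. -/
abbrev orderUnit : Matrix (Fin m) (Fin m) (MonoidAlgebra ℂ Γ) :=
  Matrix.scalar (Fin m) R.laplacianZero

variable {m}

theorem rowSquare_mem_squareCone {r : Fin m → MonoidAlgebra ℂ Γ} (hr : r ∈ R.augRows m) :
    rowSquare r ∈ R.squareCone m :=
  Submodule.subset_span ⟨r, hr, rfl⟩

theorem conjTranspose_mul_self_mem_squareCone {p : ℕ}
    {M : Matrix (Fin p) (Fin m) (MonoidAlgebra ℂ Γ)} (hM : ∀ i, M i ∈ R.augRows m) :
    Mᴴ * M ∈ R.squareCone m := by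
  rw [conjTranspose_mul_self_eq_sum]
  exact Submodule.sum_mem _ fun i _ => R.rowSquare_mem_squareCone (hM i)

theorem mul_orderUnit_mem_augRows {p : ℕ} (M : Matrix (Fin p) (Fin m) (MonoidAlgebra ℂ Γ))
    (i : Fin p) : (M * R.orderUnit m) i ∈ R.augRows m := by
  rw [mem_augRows]
  intro j
  rw [orderUnit, Matrix.scalar_apply, Matrix.mul_diagonal]
  exact R.augIdeal.smul_mem _ R.laplacianZero_mem_augIdeal

theorem conjTranspose_orderUnit : (R.orderUnit m)ᴴ = R.orderUnit m := by
  simp [orderUnit, Matrix.scalar_apply, Matrix.diagonal_conjTranspose, Pi.star_def,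
    R.star_laplacianZero]

theorem orderUnit_eq_sum :
    R.orderUnit m = ∑ j, ∑ i, rowSquare (Pi.single j (R.gen i)) := by
  ext1 a b
  simp only [Matrix.sum_apply, Matrix.vecMulVec_apply, Pi.star_apply]
  rw [Finset.sum_eq_single a]
  · rcases eq_or_ne a b with rfl | h
    · simp [R.laplacianZero_eq]
    · simp [h]
  · intro j _ hj
    simp [Pi.single_eq_of_ne hj.symm]
  · simp

theorem orderUnit_mem_squareCone : R.orderUnit m ∈ R.squareCone m := by
  rw [orderUnit_eq_sum]
  exact Submodule.sum_mem _ fun j _ => Submodule.sum_mem _ fun i _ =>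
    R.rowSquare_mem_squareCone (R.single_mem_augRows m (R.gen_mem_augIdeal i) j)

/-- The rows whose square is dominated by a multiple of `Δ₀`. -/
def DominatedRow (r : Fin m → MonoidAlgebra ℂ Γ) : Prop :=
  r ∈ R.augRows m ∧ ∃ t : ℝ, t • R.orderUnit m - rowSquare r ∈ R.squareCone m

theorem DominatedRow.add {r s : Fin m → MonoidAlgebra ℂ Γ} (hr : R.DominatedRow r)
    (hs : R.DominatedRow s) : R.DominatedRow (r + s) := by
  obtain ⟨hr, t, ht⟩ := hr
  obtain ⟨hs, u, hu⟩ := hs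
  refine ⟨add_mem hr hs, 2 * t + 2 * u, ?_⟩
  have h := (R.squareCone m).add_mem ((R.squareCone m).add_mem
    (cone_smul_mem _ zero_le_two ht) (cone_smul_mem _ zero_le_two hu))
    (R.rowSquare_mem_squareCone (sub_mem hr hs))
  convert h using 1
  rw [smul_sub, smul_sub, ← sub_eq_zero]
  have := rowSquare_add_add_rowSquare_sub r s
  rw [← sub_eq_zero] at this
  rw [← neg_eq_zero, ← this]
  module

theorem DominatedRow.zero : R.DominatedRow (0 : Fin m → MonoidAlgebra ℂ Γ) :=
  ⟨zero_mem _, 0, by simp⟩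

theorem DominatedRow.smul {r : Fin m → MonoidAlgebra ℂ Γ} (hr : R.DominatedRow r)
    (a : MonoidAlgebra ℂ Γ) : R.DominatedRow (a • r) := by
  induction a using MonoidAlgebra.induction_linear with
  | zero => simpa using DominatedRow.zero R
  | add a b ha hb => rw [add_smul]; exact ha.add R hb
  | single γ c =>
    obtain ⟨hr, t, ht⟩ := hr
    refine ⟨Submodule.smul_mem _ _ hr, ‖c‖ ^ 2 * t, ?_⟩
    rw [rowSquare_single_smul, mul_smul, ← smul_sub]
    exact cone_smul_mem _ (by positivity) ht

theorem DominatedRow.sum {ι : Type} (s : Finset ι) (r : ι → Fin m → MonoidAlgebra ℂ Γ)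
    (h : ∀ i ∈ s, R.DominatedRow (r i)) : R.DominatedRow (∑ i ∈ s, r i) :=
  Finset.sum_induction _ _ (fun _ _ h₁ h₂ => h₁.add R h₂) (DominatedRow.zero R) h

theorem dominatedRow_single_gen (j : Fin m) (i : Fin (R.rank 1)) :
    R.DominatedRow (Pi.single j (R.gen i)) := by
  refine ⟨R.single_mem_augRows m (R.gen_mem_augIdeal i) j, 1, ?_⟩
  have hmem : ∀ j i, rowSquare (Pi.single j (R.gen i)) ∈ R.squareCone m := fun j i =>
    R.rowSquare_mem_squareCone (R.single_mem_augRows m (R.gen_mem_augIdeal i) j)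
  rw [one_smul, orderUnit_eq_sum, ← Finset.add_sum_erase _ _ (Finset.mem_univ j),
    ← Finset.add_sum_erase _ _ (Finset.mem_univ i), add_assoc, add_sub_cancel_left]
  exact add_mem (Submodule.sum_mem _ fun i _ => hmem j i)
    (Submodule.sum_mem _ fun j _ => Submodule.sum_mem _ fun i _ => hmem j i)

theorem dominatedRow_of_mem {r : Fin m → MonoidAlgebra ℂ Γ} (hr : r ∈ R.augRows m) :
    R.DominatedRow r := by
  have h : r = ∑ j, Pi.single j (r j) := by
    ext1 i
    simp [Finset.sum_apply, Pi.single_apply]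
  rw [h]
  refine DominatedRow.sum R _ _ fun j _ => ?_
  obtain ⟨y, hy⟩ := (R.mem_augIdeal_iff _).1 (R.mem_augRows.1 hr j)
  have h' : (Pi.single j (r j) : Fin m → MonoidAlgebra ℂ Γ) =
      ∑ i, y i • Pi.single j (R.gen i) := by
    rw [← hy]
    ext1 a
    rcases eq_or_ne a j with rfl | ha
    · simp
    · simp [ha]
  rw [h']
  exact DominatedRow.sum R _ _ fun i _ => (R.dominatedRow_single_gen j i).smul R _

/-- The element `Δ₀` is an order unit: it dominates, up to a factor, all sums of squares. -/
theorem exists_smul_orderUnit_sub_mem (c : Matrix (Fin m) (Fin m) (MonoidAlgebra ℂ Γ))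
    (hc : c ∈ R.squareCone m) : ∃ t : ℝ, t • R.orderUnit m - c ∈ R.squareCone m := by
  induction hc using Submodule.span_induction with
  | mem c hc =>
    obtain ⟨r, hr, rfl⟩ := hc
    exact (R.dominatedRow_of_mem hr).2
  | zero => exact ⟨0, by simp⟩
  | add c d _ _ hc hd =>
    obtain ⟨t, ht⟩ := hc
    obtain ⟨u, hu⟩ := hd
    refine ⟨t + u, ?_⟩
    convert add_mem ht hu using 1
    module
  | smul s c _ hc =>
    obtain ⟨t, ht⟩ := hc
    refine ⟨s * t, ?_⟩
    convert cone_smul_mem _ s.2 ht using 1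
    rw [smul_sub, mul_smul]
    rfl

/-- The elements of the cone are sums of squares of square matrices. -/
theorem exists_sum_of_squares (c : Matrix (Fin m) (Fin m) (MonoidAlgebra ℂ Γ))
    (hc : c ∈ R.squareCone m) : ∃ (j : ℕ) (x : Fin j → Matrix (Fin m) (Fin m) (MonoidAlgebra ℂ Γ)),
      c = ∑ i, (x i)ᴴ * x i := by
  induction hc using Submodule.span_induction with
  | mem c hc =>
    obtain ⟨r, -, rfl⟩ := hc
    cases m with
    | zero => exact ⟨0, Fin.elim0, Subsingleton.elim _ _⟩
    | succ m => exact ⟨1, fun _ => _, by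
        rw [Fintype.sum_unique]
        exact rowSquare_eq_conjTranspose_mul 0 r⟩
  | zero => exact ⟨0, Fin.elim0, by simp⟩
  | add c d _ _ hc hd =>
    obtain ⟨j, x, rfl⟩ := hc
    obtain ⟨k, y, rfl⟩ := hd
    exact ⟨j + k, Fin.append x y, by simp [Fin.sum_univ_add]⟩
  | smul s c _ hc =>
    obtain ⟨j, x, rfl⟩ := hc
    refine ⟨j, fun i => ((Real.sqrt s : ℝ) : ℂ) • x i, ?_⟩
    rw [Finset.smul_sum]
    refine Finset.sum_congr rfl fun i _ => ?_
    rw [Matrix.conjTranspose_smul, Matrix.smul_mul, Matrix.mul_smul, smul_smul,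
      Complex.star_def, Complex.conj_ofReal, ← Complex.ofReal_mul, Real.mul_self_sqrt s.2,
      Complex.coe_smul]
    rfl

/-- The matrix `Δ₀ Δ_k Δ₀` is a sum of squares over the augmentation ideal. -/
theorem orderUnit_mul_laplacian_mul_orderUnit_mem (k : ℕ) :
    R.orderUnit _ * R.laplacian k * R.orderUnit _ ∈ R.squareCone (R.rank k) := by
  have h : ∀ {p : ℕ} (M : Matrix (Fin p) (Fin (R.rank k)) (MonoidAlgebra ℂ Γ)),
      R.orderUnit _ * (Mᴴ * M) * R.orderUnit _ ∈ R.squareCone (R.rank k) := fun M => by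
    have := R.conjTranspose_mul_self_mem_squareCone (R.mul_orderUnit_mem_augRows M)
    rw [Matrix.conjTranspose_mul, conjTranspose_orderUnit] at this
    simpa only [Matrix.mul_assoc] using this
  cases k with
  | zero =>
    rw [laplacian_zero]
    exact h _
  | succ k =>
    rw [laplacian_succ, mul_add, add_mul]
    refine add_mem ?_ (h _)
    simpa only [Matrix.conjTranspose_conjTranspose] using h (R.mat k)ᴴ

/-- If every state on the cone of squares over the augmentation ideal is positive on `Δ₀ Δ_k Δ₀`,
then `Δ₀ (Δ_k - ε) Δ₀` is a sum of squares for some `ε > 0`. -/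
theorem exists_sum_of_squares_of_forall_state (k : ℕ)
    (hpos : ∀ g : Matrix (Fin (R.rank k)) (Fin (R.rank k)) (MonoidAlgebra ℂ Γ) →ₗ[ℝ] ℝ,
      (∀ c ∈ R.squareCone _, 0 ≤ g c) → g (R.orderUnit _) = 1 →
        0 < g (R.orderUnit _ * R.laplacian k * R.orderUnit _)) :
    ∃ ε : ℝ, 0 < ε ∧
      ∃ (j : ℕ) (x : Fin j → Matrix (Fin (R.rank k)) (Fin (R.rank k)) (MonoidAlgebra ℂ Γ)),
        R.orderUnit _ * (R.laplacian k - (ε : ℂ) • 1) * R.orderUnit _ = ∑ i, (x i)ᴴ * x i := by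
  obtain ⟨δ, hδ, hmem⟩ := exists_sub_smul_mem_of_forall_state (R.squareCone (R.rank k))
    R.orderUnit_mem_squareCone R.exists_smul_orderUnit_sub_mem
    (Submodule.subset_span (R.orderUnit_mul_laplacian_mul_orderUnit_mem k)) hpos
  -- As `Δ₀` is an order unit, `Δ₀²` is at most a multiple of `Δ₀`.
  have hsq : R.orderUnit (R.rank k) * R.orderUnit (R.rank k) ∈ R.squareCone (R.rank k) := by
    have := R.conjTranspose_mul_self_mem_squareCone
      (R.mul_orderUnit_mem_augRows (1 : Matrix (Fin (R.rank k)) (Fin (R.rank k)) _))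
    rwa [one_mul, conjTranspose_orderUnit] at this
  obtain ⟨t, ht⟩ := R.exists_smul_orderUnit_sub_mem _ hsq
  have ht' : (|t| + 1) • R.orderUnit (R.rank k) -
      R.orderUnit (R.rank k) * R.orderUnit (R.rank k) ∈ R.squareCone (R.rank k) := by
    have := add_mem ht (cone_smul_mem _ (by linarith [le_abs_self t] : 0 ≤ |t| + 1 - t)
      R.orderUnit_mem_squareCone)
    convert this using 1
    module
  have hs : 0 < |t| + 1 := by positivity
  refine ⟨δ / (|t| + 1), div_pos hδ hs, R.exists_sum_of_squares _ ?_⟩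
  convert add_mem hmem (cone_smul_mem _ (div_pos hδ hs).le ht') using 1
  rw [smul_sub, smul_smul, div_mul_cancel₀ _ hs.ne', sub_add_sub_cancel, mul_sub, sub_mul,
    mul_smul_comm, smul_mul_assoc, mul_one, Complex.coe_smul]

end BasedResolution

end

end HigherT

/-! ### The Gelfand-Naimark-Segal construction -/

namespace HigherT

noncomputable section

section State

variable {Γ : Type} [Group Γ] {m : ℕ}

/-- The hermitian part of a real functional on square matrices over `ℂΓ`. -/
def hermitianPart (g : Matrix (Fin m) (Fin m) (MonoidAlgebra ℂ Γ) →ₗ[ℝ] ℝ) :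
    Matrix (Fin m) (Fin m) (MonoidAlgebra ℂ Γ) →ₗ[ℝ] ℝ where
  toFun x := g (x + xᴴ) / 2
  map_add' x y := by
    simp only [Matrix.conjTranspose_add, map_add]
    ring
  map_smul' c x := by
    have h : (c • x)ᴴ = c • xᴴ := by
      rw [← Complex.coe_smul, Matrix.conjTranspose_smul, Complex.star_def, Complex.conj_ofReal,
        Complex.coe_smul]
    rw [h, ← smul_add, map_smul, smul_eq_mul, smul_eq_mul, RingHom.id_apply, mul_div_assoc]

/-- The complexification of the hermitian part of a real functional on square matrices over
`ℂΓ`. -/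
def complexState (g : Matrix (Fin m) (Fin m) (MonoidAlgebra ℂ Γ) →ₗ[ℝ] ℝ) :
    Matrix (Fin m) (Fin m) (MonoidAlgebra ℂ Γ) →ₗ[ℂ] ℂ :=
  Module.Dual.extendRCLike (hermitianPart g)

theorem complexState_apply (g : Matrix (Fin m) (Fin m) (MonoidAlgebra ℂ Γ) →ₗ[ℝ] ℝ)
    (x : Matrix (Fin m) (Fin m) (MonoidAlgebra ℂ Γ)) :
    complexState g x = ((g (x + xᴴ) / 2 : ℝ) : ℂ) -
      Complex.I * ((g (Complex.I • x + (Complex.I • x)ᴴ) / 2 : ℝ) : ℂ) :=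
  Module.Dual.extendRCLike_apply (hermitianPart g) x

theorem complexState_conjTranspose (g : Matrix (Fin m) (Fin m) (MonoidAlgebra ℂ Γ) →ₗ[ℝ] ℝ)
    (x : Matrix (Fin m) (Fin m) (MonoidAlgebra ℂ Γ)) :
    complexState g xᴴ = starRingEnd ℂ (complexState g x) := by
  have h : Complex.I • xᴴ + (Complex.I • xᴴ)ᴴ = -(Complex.I • x + (Complex.I • x)ᴴ) := by
    simp [Matrix.conjTranspose_smul]
  rw [complexState_apply, complexState_apply, h, map_neg, Matrix.conjTranspose_conjTranspose,
    add_comm xᴴ, map_sub, map_mul, Complex.conj_ofReal, Complex.conj_ofReal, Complex.conj_I]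
  push_cast
  ring

theorem complexState_of_isHermitian (g : Matrix (Fin m) (Fin m) (MonoidAlgebra ℂ Γ) →ₗ[ℝ] ℝ)
    {x : Matrix (Fin m) (Fin m) (MonoidAlgebra ℂ Γ)} (hx : xᴴ = x) :
    complexState g x = g x := by
  have h : Complex.I • x + (Complex.I • x)ᴴ = 0 := by
    simp [Matrix.conjTranspose_smul, hx]
  rw [complexState_apply, h, hx, map_zero, map_add]
  simp

/-- A hermitian functional on square matrices over `ℂΓ` which is nonnegative on the squares of the
rows from a submodule `S`. -/
structure State (S : Submodule (MonoidAlgebra ℂ Γ) (Fin m → MonoidAlgebra ℂ Γ)) where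
  /-- the functional -/
  toFun : Matrix (Fin m) (Fin m) (MonoidAlgebra ℂ Γ) →ₗ[ℂ] ℂ
  map_conjTranspose : ∀ x, toFun xᴴ = starRingEnd ℂ (toFun x)
  nonneg : ∀ r ∈ S, 0 ≤ (toFun (rowSquare r)).re

namespace State

variable {S : Submodule (MonoidAlgebra ℂ Γ) (Fin m → MonoidAlgebra ℂ Γ)} (φ : State S)

set_option linter.unusedVariables false in
/-- The module `S` as a pre-Hilbert space with the inner product `⟪r, s⟫ = φ(r^* s)`. -/
def Pre (φ : State S) : Type := S

instance : AddCommGroup φ.Pre := inferInstanceAs (AddCommGroup S)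
instance : Module (MonoidAlgebra ℂ Γ) φ.Pre := inferInstanceAs (Module (MonoidAlgebra ℂ Γ) S)
instance : Module ℂ φ.Pre := inferInstanceAs (Module ℂ S)

/-- The row vector underlying an element of the pre-Hilbert space. -/
def row : φ.Pre →ₗ[MonoidAlgebra ℂ Γ] (Fin m → MonoidAlgebra ℂ Γ) := S.subtype

/-- A row from `S` as an element of the pre-Hilbert space. -/
def ofRow (r : Fin m → MonoidAlgebra ℂ Γ) (hr : r ∈ S) : φ.Pre := Subtype.mk (p := (· ∈ S)) r hr

theorem row_ofRow (r : Fin m → MonoidAlgebra ℂ Γ) (hr : r ∈ S) : φ.row (φ.ofRow r hr) = r := rfl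

theorem row_injective : Function.Injective φ.row := S.injective_subtype

theorem row_smul (c : ℂ) (r : φ.Pre) : φ.row (c • r) = c • φ.row r := rfl

theorem row_mem (r : φ.Pre) : φ.row r ∈ S := Subtype.prop (p := (· ∈ S)) r

/-- The inner product on the pre-Hilbert space. -/
abbrev preCore : PreInnerProductSpace.Core ℂ φ.Pre where
  inner r s := φ.toFun (Matrix.vecMulVec (star (φ.row r)) (φ.row s))
  conj_inner_symm r s := by
    rw [← φ.map_conjTranspose]
    congr 1
    ext1 a b
    simp [Matrix.vecMulVec_apply]
  re_inner_nonneg r := φ.nonneg _ (φ.row_mem r)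
  add_left r s t := by
    rw [← map_add, map_add, star_add, Matrix.add_vecMulVec]
  smul_left r s c := by
    rw [← smul_eq_mul, ← map_smul, row_smul, star_smul, Matrix.smul_vecMulVec]
    rfl

instance : SeminormedAddCommGroup φ.Pre :=
  InnerProductSpace.Core.toSeminormedAddCommGroup (c := φ.preCore)

instance : InnerProductSpace ℂ φ.Pre := InnerProductSpace.ofCore φ.preCore

theorem inner_pre (r s : φ.Pre) :
    inner ℂ r s = φ.toFun (Matrix.vecMulVec (star (φ.row r)) (φ.row s)) := rfl

theorem norm_single_smul (γ : Γ) (r : φ.Pre) :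
    ‖MonoidAlgebra.single γ (1 : ℂ) • r‖ = ‖r‖ := by
  have h : inner ℂ (MonoidAlgebra.single γ (1 : ℂ) • r) (MonoidAlgebra.single γ (1 : ℂ) • r) =
      inner ℂ r r := by
    have := rowSquare_single_smul γ 1 (φ.row r)
    rw [inner_pre, inner_pre, map_smul]
    refine (congrArg φ.toFun this).trans ?_
    simp
  rw [@norm_eq_sqrt_re_inner ℂ, h, ← @norm_eq_sqrt_re_inner ℂ]

/-- The action of a group element on the pre-Hilbert space. -/
def preAction (γ : Γ) : φ.Pre →ₗᵢ[ℂ] φ.Pre where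
  toFun r := MonoidAlgebra.single γ (1 : ℂ) • r
  map_add' r s := smul_add _ r s
  map_smul' c r := by
    apply S.injective_subtype
    change MonoidAlgebra.single γ (1 : ℂ) • (c • φ.row r) = c • MonoidAlgebra.single γ (1 : ℂ) • _
    ext1 i
    simp
    rfl
  norm_map' r := φ.norm_single_smul γ r

/-- The Hilbert space of the Gelfand-Naimark-Segal construction. -/
abbrev GNS : Type := UniformSpace.Completion φ.Pre

open UniformSpace

/-- The unitary representation on the Hilbert space of the Gelfand-Naimark-Segal construction. -/
def gnsRepresentation : Representation ℂ Γ φ.GNS where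
  toFun γ := (φ.preAction γ).toContinuousLinearMap.completion.toLinearMap
  map_one' := by
    refine LinearMap.ext fun v => ?_
    induction v using Completion.induction_on with
    | hp => exact isClosed_eq (ContinuousLinearMap.continuous _) continuous_id
    | ih r =>
      refine (ContinuousLinearMap.completion_apply_coe _ _).trans ?_
      change ((MonoidAlgebra.single (1 : Γ) (1 : ℂ) • r : φ.Pre) : φ.GNS) = r
      rw [← MonoidAlgebra.one_def, one_smul]
  map_mul' γ δ := by
    refine LinearMap.ext fun v => ?_
    induction v using Completion.induction_on with
    | hp =>
      exact isClosed_eq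
        ((φ.preAction (γ * δ)).toContinuousLinearMap.completion).continuous
        (((φ.preAction γ).toContinuousLinearMap.completion ∘L
          (φ.preAction δ).toContinuousLinearMap.completion).continuous)
    | ih r =>
      refine (ContinuousLinearMap.completion_apply_coe _ _).trans ?_
      refine Eq.trans ?_ (congrArg (φ.preAction γ).toContinuousLinearMap.completion
        (ContinuousLinearMap.completion_apply_coe _ _)).symm
      refine Eq.trans ?_ (ContinuousLinearMap.completion_apply_coe _ _).symm
      change ((MonoidAlgebra.single (γ * δ) (1 : ℂ) • r : φ.Pre) : φ.GNS) =
        ((MonoidAlgebra.single γ (1 : ℂ) • MonoidAlgebra.single δ (1 : ℂ) • r : φ.Pre) : φ.GNS)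
      rw [smul_smul, MonoidAlgebra.single_mul_single, one_mul]

theorem gnsRepresentation_coe (γ : Γ) (r : φ.Pre) :
    φ.gnsRepresentation γ r = ((MonoidAlgebra.single γ (1 : ℂ) • r : φ.Pre) : φ.GNS) :=
  ContinuousLinearMap.completion_apply_coe _ _

theorem norm_gnsRepresentation (γ : Γ) (v : φ.GNS) : ‖φ.gnsRepresentation γ v‖ = ‖v‖ := by
  induction v using Completion.induction_on with
  | hp => exact isClosed_eq (ContinuousLinearMap.continuous
      (φ.preAction γ).toContinuousLinearMap.completion).norm continuous_norm
  | ih r => rw [gnsRepresentation_coe, Completion.norm_coe, Completion.norm_coe,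
      φ.norm_single_smul]

theorem asAlgebraHom_gnsRepresentation_coe (a : MonoidAlgebra ℂ Γ) (r : φ.Pre) :
    φ.gnsRepresentation.asAlgebraHom a r = ((a • r : φ.Pre) : φ.GNS) := by
  induction a using MonoidAlgebra.induction_linear with
  | zero =>
    rw [map_zero, LinearMap.zero_apply, zero_smul]
    exact (Completion.coe_zero).symm
  | add a b ha hb =>
    rw [map_add, LinearMap.add_apply, ha, hb, add_smul]
    exact (Completion.coe_add _ _).symm
  | single γ c =>
    rw [Representation.asAlgebraHom_single, LinearMap.smul_apply, gnsRepresentation_coe,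
      ← Completion.coe_smul]
    congr 1
    apply S.injective_subtype
    change c • MonoidAlgebra.single γ (1 : ℂ) • φ.row r = MonoidAlgebra.single γ c • φ.row r
    rw [← smul_assoc, MonoidAlgebra.smul_single, smul_eq_mul, mul_one]

/-- The vector of the Hilbert space given by a row from `S`. -/
def vec (r : Fin m → MonoidAlgebra ℂ Γ) (hr : r ∈ S) : φ.GNS := (φ.ofRow r hr : φ.GNS)

/-- The vectors given by the rows of a matrix. -/
def vecs {p : ℕ} (N : Matrix (Fin p) (Fin m) (MonoidAlgebra ℂ Γ)) (hN : ∀ i, N i ∈ S) :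
    Fin p → φ.GNS := fun i => φ.vec (N i) (hN i)

theorem inner_vec (r s : Fin m → MonoidAlgebra ℂ Γ) (hr : r ∈ S) (hs : s ∈ S) :
    inner ℂ (φ.vec r hr) (φ.vec s hs) = φ.toFun (Matrix.vecMulVec (star r) s) := by
  rw [vec, vec, Completion.inner_coe, inner_pre, row_ofRow, row_ofRow]

theorem sum_inner_vecs {p : ℕ} (N : Matrix (Fin p) (Fin m) (MonoidAlgebra ℂ Γ))
    (hN : ∀ i, N i ∈ S) :
    ∑ i, inner ℂ (φ.vecs N hN i) (φ.vecs N hN i) = φ.toFun (Nᴴ * N) := by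
  rw [conjTranspose_mul_self_eq_sum, map_sum]
  exact Finset.sum_congr rfl fun i _ => φ.inner_vec _ _ _ _

theorem mul_row_mem {p q : ℕ} (M : Matrix (Fin p) (Fin q) (MonoidAlgebra ℂ Γ))
    (N : Matrix (Fin q) (Fin m) (MonoidAlgebra ℂ Γ)) (hN : ∀ i, N i ∈ S) (i : Fin p) :
    (M * N) i ∈ S := by
  have : (M * N) i = ∑ j, M i j • N j := by
    ext1 a
    simp [Matrix.mul_apply]
  rw [this]
  exact Submodule.sum_mem _ fun j _ => S.smul_mem _ (hN j)

theorem matAct_vecs {p q : ℕ} (M : Matrix (Fin p) (Fin q) (MonoidAlgebra ℂ Γ))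
    (N : Matrix (Fin q) (Fin m) (MonoidAlgebra ℂ Γ)) (hN : ∀ i, N i ∈ S) :
    matAct φ.gnsRepresentation M (φ.vecs N hN) = φ.vecs (M * N) (mul_row_mem M N hN) := by
  ext1 i
  rw [matAct_apply]
  have : ((M * N) i) = ∑ j, M i j • N j := by
    ext1 a
    simp [Matrix.mul_apply]
  have hs : ∀ f : Fin q → φ.Pre, ∑ j, (f j : φ.GNS) = ((∑ j, f j : φ.Pre) : φ.GNS) := fun f =>
    (map_sum (Completion.toCompl : φ.Pre →+ φ.GNS) f Finset.univ).symm
  refine (Finset.sum_congr rfl fun j _ =>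
    φ.asAlgebraHom_gnsRepresentation_coe (M i j) (φ.ofRow (N j) (hN j))).trans ?_
  rw [hs, vecs, vec]
  congr 1
  apply φ.row_injective
  rw [map_sum, row_ofRow, this]
  rfl

theorem eq_zero_of_inner_vec {u : φ.GNS} (h : ∀ r hr, inner ℂ u (φ.vec r hr) = 0) : u = 0 := by
  have : ∀ v : φ.GNS, inner ℂ u v = 0 := fun v => by
    induction v using Completion.induction_on with
    | hp => exact isClosed_eq (continuous_const.inner continuous_id) continuous_const
    | ih r => exact h (φ.row r) (φ.row_mem r)
  exact inner_self_eq_zero.1 (this u)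

end State

end State
end
end HigherT

/-! ### Positivity of states under property `(T_n)` -/

namespace HigherT

noncomputable section

namespace BasedResolution

variable {Γ : Type} [Group Γ] (R : BasedResolution Γ) {m : ℕ}

theorem mem_span_of_mem_augIdeal {x : MonoidAlgebra ℂ Γ} (hx : x ∈ R.augIdeal) :
    x ∈ Submodule.span ℂ
      (Set.range fun γ : Γ => (MonoidAlgebra.single γ 1 - 1 : MonoidAlgebra ℂ Γ)) := by
  have h₁ : ∀ y : MonoidAlgebra ℂ Γ, y - MonoidAlgebra.lift ℂ ℂ Γ 1 y • 1 ∈ Submodule.span ℂ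
      (Set.range fun γ : Γ => (MonoidAlgebra.single γ 1 - 1 : MonoidAlgebra ℂ Γ)) := fun y => by
    induction y using MonoidAlgebra.induction_linear with
    | zero => simp
    | add a b ha hb =>
      convert add_mem ha hb using 1
      rw [map_add]
      module
    | single γ c =>
      convert Submodule.smul_mem _ c (Submodule.subset_span (Set.mem_range_self γ)) using 1
      simp [smul_sub]
  have h₂ : MonoidAlgebra.lift ℂ ℂ Γ 1 x = 0 := by
    obtain ⟨y, rfl⟩ := (R.mem_augIdeal_iff x).1 hx
    simp [R.sum_coeff_gen]
  simpa [h₂] using h₁ x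

end BasedResolution

namespace State

variable {Γ : Type} [Group Γ] {m : ℕ}

section Vectors

variable {S : Submodule (MonoidAlgebra ℂ Γ) (Fin m → MonoidAlgebra ℂ Γ)} (φ : State S)

theorem vecs_of_eq_zero {p : ℕ} {N : Matrix (Fin p) (Fin m) (MonoidAlgebra ℂ Γ)}
    (hN : ∀ i, N i ∈ S) (h : N = 0) : φ.vecs N hN = 0 := by
  subst h
  exact funext fun _ => UniformSpace.Completion.coe_zero (α := φ.Pre)

theorem vec_add {r s : Fin m → MonoidAlgebra ℂ Γ} (hr : r ∈ S) (hs : s ∈ S) :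
    φ.vec (r + s) (add_mem hr hs) = φ.vec r hr + φ.vec s hs :=
  UniformSpace.Completion.coe_add (φ.ofRow r hr) (φ.ofRow s hs)

theorem vec_smul (c : ℂ) {r : Fin m → MonoidAlgebra ℂ Γ} (hr : r ∈ S) :
    φ.vec (c • r) (S.smul_of_tower_mem c hr) = c • φ.vec r hr :=
  UniformSpace.Completion.coe_smul c (φ.ofRow r hr)

theorem gnsRepresentation_vec (γ : Γ) {r : Fin m → MonoidAlgebra ℂ Γ} (hr : r ∈ S) :
    φ.gnsRepresentation γ (φ.vec r hr) =
      φ.vec (MonoidAlgebra.single γ (1 : ℂ) • r) (S.smul_mem _ hr) :=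
  φ.gnsRepresentation_coe γ (φ.ofRow r hr)

end Vectors

variable {R : BasedResolution Γ} (φ : State (R.augRows m))

/-- Pairing with an invariant vector `u` gives for every coordinate `j` an additive character
`γ ↦ ⟪u, (γ - 1) e_j⟫`, which vanishes under property `(T_n)`. -/
theorem eq_zero_of_invariant {n : ℕ} (hn : 1 ≤ n) (hT : PropertyT n Γ) (u : φ.GNS)
    (hu : ∀ γ, φ.gnsRepresentation γ u = u) : u = 0 := by
  have hsingle : ∀ (j : Fin m) (γ : Γ), inner ℂ u (φ.vec _
      (R.single_mem_augRows m (R.single_sub_one_mem_augIdeal γ) j)) = 0 := fun j => by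
    refine complex_character_eq_zero hn hT (b := fun γ => inner ℂ u (φ.vec _
      (R.single_mem_augRows m (R.single_sub_one_mem_augIdeal γ) j))) fun γ δ => ?_
    -- The character is additive because `γ δ - 1 = (γ - 1) + γ (δ - 1)`.
    have h : (Pi.single j (MonoidAlgebra.single (γ * δ) 1 - 1) : Fin m → MonoidAlgebra ℂ Γ) =
        Pi.single j (MonoidAlgebra.single γ 1 - 1) +
          MonoidAlgebra.single γ (1 : ℂ) • Pi.single j (MonoidAlgebra.single δ 1 - 1) := by
      rw [← Pi.single_smul, ← Pi.single_add, smul_eq_mul, mul_sub, MonoidAlgebra.single_mul_single,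
        mul_one, mul_one]
      congr 1
      abel
    have hδ := R.single_mem_augRows m (R.single_sub_one_mem_augIdeal δ) j
    simp only [h]
    rw [φ.vec_add (R.single_mem_augRows m (R.single_sub_one_mem_augIdeal γ) j)
      ((R.augRows m).smul_mem _ hδ), inner_add_right, ← φ.gnsRepresentation_vec γ hδ]
    congr 1
    conv_lhs => rw [← hu γ]
    exact inner_unitary φ.norm_gnsRepresentation γ _ _
  have hmem : ∀ (j : Fin m) (x : MonoidAlgebra ℂ Γ) (hx : x ∈ R.augIdeal),
      inner ℂ u (φ.vec _ (R.single_mem_augRows m hx j)) = 0 := fun j x hx => by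
    have : ∃ h : x ∈ R.augIdeal, inner ℂ u (φ.vec _ (R.single_mem_augRows m h j)) = 0 := by
      have hspan := R.mem_span_of_mem_augIdeal hx
      clear hx
      induction hspan using Submodule.span_induction with
      | mem x hx =>
        obtain ⟨γ, rfl⟩ := hx
        exact ⟨R.single_sub_one_mem_augIdeal γ, hsingle j γ⟩
      | zero =>
        refine ⟨zero_mem _, ?_⟩
        simp only [Pi.single_zero]
        exact (congrArg (inner ℂ u) (UniformSpace.Completion.coe_zero (α := φ.Pre))).trans
          (inner_zero_right u)
      | add x y _ _ hx hy =>
        obtain ⟨hx, hx'⟩ := hx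
        obtain ⟨hy, hy'⟩ := hy
        refine ⟨add_mem hx hy, ?_⟩
        simp only [Pi.single_add]
        rw [φ.vec_add (R.single_mem_augRows m hx j) (R.single_mem_augRows m hy j),
          inner_add_right, hx', hy', add_zero]
      | smul c x _ hx =>
        obtain ⟨hx, hx'⟩ := hx
        refine ⟨Submodule.smul_of_tower_mem _ c hx, ?_⟩
        simp only [Pi.single_smul]
        rw [φ.vec_smul c (R.single_mem_augRows m hx j), inner_smul_right, hx', mul_zero]
    exact this.2
  refine φ.eq_zero_of_inner_vec fun r hr => ?_
  have hr' := R.mem_augRows.1 hr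
  have key : ∀ s : Finset (Fin m), ∃ h : ∑ j ∈ s, Pi.single j (r j) ∈ R.augRows m,
      inner ℂ u (φ.vec _ h) = 0 := fun s => by
    induction s using Finset.induction_on with
    | empty =>
      refine ⟨zero_mem _, ?_⟩
      exact (congrArg (inner ℂ u) (UniformSpace.Completion.coe_zero (α := φ.Pre))).trans
          (inner_zero_right u)
    | insert j s hj ih =>
      obtain ⟨h, ih⟩ := ih
      have hj' := R.single_mem_augRows m (hr' j) j
      simp only [Finset.sum_insert hj]
      exact ⟨add_mem hj' h, by rw [φ.vec_add hj' h, inner_add_right, hmem j _ (hr' j), ih,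
        add_zero]⟩
  have hsum : ∑ j, Pi.single j (r j) = r := Finset.univ_sum_single r
  have := key Finset.univ
  simp only [hsum] at this
  exact this.2

/-- The rows with the entries of `d_1` in the coordinate `j` form a `1`-cocycle, whose image under
the adjoint of the coboundary is the row with `Δ₀` in the coordinate `j`. If that is the zero vector,
so are the former rows, as `1`-cocycles are coboundaries; the order unit is the sum of their
squares. -/
theorem map_orderUnit_eq_zero {n : ℕ} (hn : 1 ≤ n) (hT : PropertyT n Γ)
    (h : ∀ j, φ.vec _ (R.single_mem_augRows m R.laplacianZero_mem_augIdeal j) = 0) :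
    φ.toFun (R.orderUnit m) = 0 := by
  have hcoh := (R.subsingleton_groupCohomology_iff φ.gnsRepresentation 0).1
    (hT _ _ φ.norm_gnsRepresentation (φ.eq_zero_of_invariant hn hT) 1 le_rfl hn)
  have hgen : ∀ j i, φ.vec _ (R.single_mem_augRows m (R.gen_mem_augIdeal i) j) = 0 := fun j => by
    let E : Matrix (Fin (R.rank 0)) (Fin m) (MonoidAlgebra ℂ Γ) := Matrix.of fun _ => Pi.single j 1
    have hmul : ∀ {p : ℕ} (M : Matrix (Fin p) (Fin (R.rank 0)) (MonoidAlgebra ℂ Γ)) (i : Fin p),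
        (M * E) i = Pi.single j (M i R.idx) := fun M i => by
      ext1 a
      rw [Matrix.mul_apply, Fintype.sum_unique]
      rcases eq_or_ne a j with rfl | ha
      · simp [E, Unique.default_eq R.idx]
      · simp [E, ha]
    have hN : ∀ i, (R.mat 0 * E) i ∈ R.augRows m := fun i => by
      rw [hmul]
      exact R.single_mem_augRows m (R.gen_mem_augIdeal i) j
    have hzero : φ.vecs (R.mat 0 * E) hN = 0 := by
      obtain ⟨w, hw⟩ := hcoh (φ.vecs (R.mat 0 * E) hN) (by
        rw [φ.matAct_vecs]
        have hd : R.mat 1 * (R.mat 0 * E) = 0 := by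
          rw [← Matrix.mul_assoc, R.mat_mul_mat, Matrix.zero_mul]
        exact φ.vecs_of_eq_zero _ hd)
      rw [hw]
      apply matAct_eq_zero_of_conjTranspose_mul φ.norm_gnsRepresentation
      rw [← hw, φ.matAct_vecs]
      ext1 i
      refine Eq.trans ?_ (h j)
      simp only [vecs]
      congr 1
      rw [← Matrix.mul_assoc, ← R.laplacian_zero, hmul, Subsingleton.elim i R.idx]
      rfl
    intro i
    refine Eq.trans ?_ (congrFun hzero i)
    simp only [vecs]
    congr 1
    exact (hmul _ i).symm
  rw [R.orderUnit_eq_sum, map_sum]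
  refine Finset.sum_eq_zero fun j _ => ?_
  rw [map_sum]
  refine Finset.sum_eq_zero fun i _ => ?_
  have hmem := R.single_mem_augRows m (R.gen_mem_augIdeal i) j
  rw [← φ.inner_vec _ _ hmem hmem, hgen, inner_zero_right]

end State

namespace BasedResolution

variable {Γ : Type} [Group Γ] (R : BasedResolution Γ)

/-- A state which is not positive on `Δ₀ Δ_k Δ₀` has, in its representation, a harmonic vector given
by the rows of `Δ₀`. Under property `(T_n)` this vector is zero. -/
theorem state_pos {n : ℕ} (hn : 1 ≤ n) (hT : PropertyT n Γ) {k : ℕ} (hk : k ≤ n)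
    (g : Matrix (Fin (R.rank k)) (Fin (R.rank k)) (MonoidAlgebra ℂ Γ) →ₗ[ℝ] ℝ)
    (hg : ∀ c ∈ R.squareCone _, 0 ≤ g c) (hg₁ : g (R.orderUnit _) = 1) :
    0 < g (R.orderUnit _ * R.laplacian k * R.orderUnit _) := by
  by_contra hneg
  have hsq : ∀ r : Fin (R.rank k) → MonoidAlgebra ℂ Γ, (rowSquare r)ᴴ = rowSquare r := fun r => by
    ext1 a b
    simp [Matrix.vecMulVec_apply]
  let φ : State (R.augRows (R.rank k)) :=
    { toFun := complexState g
      map_conjTranspose := complexState_conjTranspose g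
      nonneg := fun r hr => by
        rw [complexState_of_isHermitian g (hsq r), Complex.ofReal_re]
        exact hg _ (R.rowSquare_mem_squareCone hr) }
  have hrow : ∀ i, R.orderUnit (R.rank k) i ∈ R.augRows (R.rank k) := fun i => by
    simpa using R.mul_orderUnit_mem_augRows (1 : Matrix (Fin (R.rank k)) (Fin (R.rank k)) _) i
  let ξ := φ.vecs (R.orderUnit (R.rank k)) hrow
  have hU := φ.norm_gnsRepresentation
  have hinv := φ.eq_zero_of_invariant hn hT
  have hval : ∀ {p : ℕ} (M : Matrix (Fin p) (Fin (R.rank k)) (MonoidAlgebra ℂ Γ)),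
      g (R.orderUnit _ * (Mᴴ * M) * R.orderUnit _) =
        ∑ i, ‖matAct φ.gnsRepresentation M ξ i‖ ^ 2 := fun M => by
    have hM : R.orderUnit _ * (Mᴴ * M) * R.orderUnit _ =
        (M * R.orderUnit (R.rank k))ᴴ * (M * R.orderUnit (R.rank k)) := by
      rw [Matrix.conjTranspose_mul, R.conjTranspose_orderUnit]
      simp only [Matrix.mul_assoc]
    have h₁ := φ.sum_inner_vecs (M * R.orderUnit (R.rank k)) (R.mul_orderUnit_mem_augRows M)
    rw [sum_inner_self] at h₁
    have h₂ : φ.toFun ((M * R.orderUnit (R.rank k))ᴴ * (M * R.orderUnit (R.rank k))) =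
        g ((M * R.orderUnit (R.rank k))ᴴ * (M * R.orderUnit (R.rank k))) :=
      complexState_of_isHermitian g (by simp)
    rw [h₂] at h₁
    rw [hM, ← Complex.ofReal_injective h₁, φ.matAct_vecs]
  have hzero : ∀ {p : ℕ} (M : Matrix (Fin p) (Fin (R.rank k)) (MonoidAlgebra ℂ Γ)),
      g (R.orderUnit _ * (Mᴴ * M) * R.orderUnit _) ≤ 0 → matAct φ.gnsRepresentation M ξ = 0 :=
    fun M hM => by
      apply eq_zero_of_sum_inner_self
      rw [sum_inner_self, ← hval M, Complex.ofReal_eq_zero]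
      refine le_antisymm hM ?_
      rw [hval]
      positivity
  have hnonneg : ∀ {p : ℕ} (M : Matrix (Fin p) (Fin (R.rank k)) (MonoidAlgebra ℂ Γ)),
      0 ≤ g (R.orderUnit _ * (Mᴴ * M) * R.orderUnit _) := fun M => by
    rw [hval]
    positivity
  have hξ : ξ = 0 := by
    clear_value ξ
    cases k with
    | zero =>
      rw [R.laplacian_zero, not_lt] at hneg
      ext1 i
      rw [Subsingleton.elim i R.idx]
      exact hinv _ (invariant_of_matAct_zero R ξ (hzero _ hneg))
    | succ k =>
      have h₁ := hnonneg (R.mat k)ᴴ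
      have h₂ := hnonneg (R.mat (k + 1))
      rw [R.laplacian_succ, not_lt, mul_add, add_mul, map_add] at hneg
      rw [Matrix.conjTranspose_conjTranspose] at h₁
      have hc := hzero (R.mat k)ᴴ (by rw [Matrix.conjTranspose_conjTranspose]; linarith)
      obtain ⟨w, hw⟩ := (R.subsingleton_groupCohomology_iff φ.gnsRepresentation k).1
        (hT _ _ hU hinv (k + 1) (by omega) hk) ξ (hzero _ (by linarith))
      apply eq_zero_of_sum_inner_self
      nth_rewrite 2 [hw]
      rw [sum_inner_matAct_right hU, hc]
      simp
  have h₀ : φ.toFun (R.orderUnit _) = 0 := φ.map_orderUnit_eq_zero hn hT fun j => by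
    refine Eq.trans ?_ (congrFun hξ j)
    simp only [ξ, State.vecs]
    congr 1
    ext1 a
    change _ = Matrix.diagonal (fun _ => R.laplacianZero) j a
    rw [Matrix.diagonal_apply, Pi.single_apply]
    simp only [eq_comm]
  have h₁ := complexState_of_isHermitian g (R.conjTranspose_orderUnit (m := R.rank k))
  rw [hg₁] at h₁
  exact one_ne_zero (α := ℂ) (by simpa using h₁.symm.trans h₀)

end BasedResolution

end

end HigherT

theorem theorem1p6 (Γ : Type) [Group Γ] (hΓ : HigherT.IsFPInfty Γ) (n : ℕ) (hn : 1 ≤ n) :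
    Nonempty (HigherT.BasedResolution Γ) ∧
    ∀ R : HigherT.BasedResolution Γ,
      HigherT.PropertyT n Γ ↔
        ∀ k ≤ n, ∃ ε : ℝ, 0 < ε ∧
          ∃ (j : ℕ) (x : Fin j → Matrix (Fin (R.rank k)) (Fin (R.rank k)) (MonoidAlgebra ℂ Γ)),
            Matrix.scalar (Fin (R.rank k)) R.laplacianZero *
                (R.laplacian k - (ε : ℂ) • 1) *
                Matrix.scalar (Fin (R.rank k)) R.laplacianZero =
              ∑ i, (x i)ᴴ * x i :=
  ⟨HigherT.nonempty_basedResolution hΓ, fun R =>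
    ⟨fun hT k hk => R.exists_sum_of_squares_of_forall_state k (R.state_pos hn hT hk),
      HigherT.propertyT_of_sum_of_squares R⟩⟩
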